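/- Let $\mathbb H^n=\mathbb R^{2n+1}$, with points $p=(x,y,t)$, $x,y\in\mathbb R^n$, $t\in\mathbb R$, be the Heisenberg group with product $(x,y,t)*(x',y',t')=(x+x',\,y+y',\,t+t'+\tfrac12(x\cdot y'-y\cdot x'))$, left-invariant frame $X_j=\partial_{x_j}-\tfrac12y_j\partial_t$, $Y_j=\partial_{y_j}+\tfrac12x_j\partial_t$, $\partial_t$ (declared orthonormal), contact form $\theta=dt-\tfrac12\sum_j(x_j\,dy_j-y_j\,dx_j)$, and Korányi distance $d_{\mathbb H}(p,q)=\|q^{-1}*p\|$, $\|(x,y,t)\|=(|(x,y)|^4+16t^2)^{1/4}$. Let $U\subseteq\mathbb H^n$ be open. Rumin forms: let $I^k=\{\alpha\wedge\theta+\beta\wedge d\theta\}$ and $J^k=\{\omega:\omega\wedge\theta=0,\ \omega\wedge d\theta=0\}$. The space $\mathcal D^k_{\mathbb H}(U)$ of smooth Rumin $k$-forms with compact support in $U$ is the space of compactly supported sections of $\Omega^k/I^k$ if $k\le n$, and of $J^k$ if $k>n$. The Rumin differential $d_c:\mathcal D^k_{\mathbb H}(U)\to\mathcal D^{k+1}_{\mathbb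 H}(U)$ is $d_c[\omega]=[d\omega]$ for $k<n$; $d_c\omega=d\omega$ for $k>n$; and, for $k=n$, $d_c[\omega]=d(\omega+\gamma)$, where $\gamma$ is the unique multiple of $\theta$ (i.e. $\theta\wedge\gamma=0$) for which $\theta\wedge d(\omega+\gamma)=0$. Heisenberg currents: a Heisenberg $k$-current $T$ in $U$ is a continuous linear functional on $\mathcal D^k_{\mathbb H}(U)$. Its boundary is $\partial T(\omega)=T(d_c\omega)$ (with $\partial T=0$ if $k=0$), and its support $\operatorname{spt}T$ is the set of $p\in U$ such that every neighbourhood $V$ of $p$ admits $\omega\in\mathcal D^k_{\mathbb H}(U)$ supported in $V$ with $T(\omega)\ne0$. Heisenberg $k$-vectors at $p$ are the $k$-vectors that annihilate $I^k$ (if $k\le n$), respectively that are metrically dual to elements of $J^k$ (if $k>n$); $\|\omega(p)\|^*$ is the supremum of $\langle\omega(p)\mid v\rangle$ over Heisenberg $k$-vectors $v$ at $p$ with $|v|\le1$, and $M(T)=\sup\{T(\omega):\|\omega(p)\|^*\le1\ \forall p\}$. $T$ is representable by integration if $T(\omega)=\int_U\langle\omega\mid\vec T\rangle\,d\mu_T$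 for a Radon measure $\mu_T$ on $U$ and a $\mu_T$-measurable field $\vec T$ of Heisenberg $k$-vectors with $|\vec T|=1$ $\mu_T$-a.e.; then, for Borel $A\subseteq U$, $(T\llcorner A)(\omega)=\int_A\langle\omega\mid\vec T\rangle\,d\mu_T$. $T$ is normal if $T$ and $\partial T$ are representable by integration and $M(T)+M(\partial T)<\infty$. Let $T$ be a normal Heisenberg $k$-current in $U$, and let $f:U\to\mathbb R$ be Lipschitz with respect to $d_{\mathbb H}$. For $t\in\mathbb R$ put $$\langle T,f,t+\rangle=(\partial T)\llcorner\{f>t\}-\partial\bigl(T\llcorner\{f>t\}\bigr),\qquad \langle T,f,t-\rangle=\partial\bigl(T\llcorner\{f<t\}\bigr)-(\partial T)\llcorner\{f<t\}.$$ Then: (0) $(\mu_T+\mu_{\partial T})(\{f=t\})=0$ for all but at most countably many $t\in\mathbb R$; (1) $\langle T,f,t+\rangle=\langle T,f,t-\rangle$ for all but at most countably many $t\in\mathbb R$; (2) $\operatorname{spt}\langle T,f,t+\rangle\subseteq f^{-1}\{t\}\cap\operatorname{spt}T$ for every $t\in\mathbb R$; (3) $\partial\langle T,f,t+\rangle=-\langle\partial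 T,f,t+\rangle$ for every $t\in\mathbb R$. -/

import Mathlib

open MeasureTheory TopologicalSpace
open scoped Distributions

noncomputable section

namespace Heis

/-! ### The Heisenberg group -/

/-- The underlying space `ℝ²ⁿ⁺¹` of the Heisenberg group `ℍⁿ`; points are `p = (x, y, t)`. -/
abbrev Pt (n : ℕ) : Type := (Fin n → ℝ) × (Fin n → ℝ) × ℝ

/-- The group law
`(x, y, t) * (x', y', t') = (x + x', y + y', t + t' + (x · y' - y · x') / 2)`. -/
def mul {n : ℕ} (p q : Pt n) : Pt n :=
  (p.1 + q.1, p.2.1 + q.2.1,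
    p.2.2 + q.2.2 + (∑ j, (p.1 j * q.2.1 j - p.2.1 j * q.1 j)) / 2)

/-- The group inverse `(x, y, t)⁻¹ = (-x, -y, -t)`. -/
def inv {n : ℕ} (p : Pt n) : Pt n := -p

/-- The Korányi norm `(|(x, y)|⁴ + 16 t²)^(1/4)`. -/
def koranyiNorm {n : ℕ} (p : Pt n) : ℝ :=
  ((∑ j, (p.1 j ^ 2 + p.2.1 j ^ 2)) ^ 2 + 16 * p.2.2 ^ 2) ^ (1 / 4 : ℝ)

/-- The Korányi distance `d(p, q) = ‖q⁻¹ * p‖`. -/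
def koranyiDist {n : ℕ} (p q : Pt n) : ℝ := koranyiNorm (mul (inv q) p)

/-- `f` is Lipschitz on `U` with respect to the Korányi distance. -/
def IsLipschitzOn {n : ℕ} (U : Opens (Pt n)) (f : Pt n → ℝ) : Prop :=
  ∃ C : ℝ, ∀ p ∈ U, ∀ q ∈ U, |f p - f q| ≤ C * koranyiDist p q

/-- The left-invariant frame `X_j = ∂_{x_j} - (y_j / 2) ∂_t`, `Y_j = ∂_{y_j} + (x_j / 2) ∂_t`,
`T = ∂_t`. -/
def frame {n : ℕ} (p : Pt n) : Fin n ⊕ Fin n ⊕ Unit → Pt n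
  | .inl j => (Pi.single j 1, 0, -(p.2.1 j) / 2)
  | .inr (.inl j) => (0, Pi.single j 1, p.1 j / 2)
  | .inr (.inr _) => (0, 0, 1)

/-- The coordinate covector `dx_j`. -/
def dx {n : ℕ} (j : Fin n) : Pt n →L[ℝ] ℝ :=
  (ContinuousLinearMap.proj j).comp (ContinuousLinearMap.fst ℝ _ _)

/-- The coordinate covector `dy_j`. -/
def dy {n : ℕ} (j : Fin n) : Pt n →L[ℝ] ℝ :=
  (ContinuousLinearMap.proj j).comp
    ((ContinuousLinearMap.fst ℝ _ _).comp (ContinuousLinearMap.snd ℝ _ _))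

/-- The coordinate covector `dt`. -/
def dt {n : ℕ} : Pt n →L[ℝ] ℝ :=
  (ContinuousLinearMap.snd ℝ _ _).comp (ContinuousLinearMap.snd ℝ _ _)

/-- The contact form `θ = dt - (1/2) ∑ (x_j dy_j - y_j dx_j)` at the point `p`. -/
def theta {n : ℕ} (p : Pt n) : Pt n →L[ℝ] ℝ :=
  dt - (1 / 2 : ℝ) • ∑ j, (p.1 j • dy j - p.2.1 j • dx j)

/-! ### Covectors and vectors -/

/-- `k`-covectors of the tangent space. -/
abbrev Cov (n k : ℕ) : Type := Pt n [⋀^Fin k]→L[ℝ] ℝ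

/-- `k`-vectors of the tangent space, as the dual of the (finite dimensional) space of
`k`-covectors; the pairing `⟨ω | v⟩` is `v ω`. -/
abbrev Vec (n k : ℕ) : Type := Cov n k →L[ℝ] ℝ

/-- Exterior multiplication `ω ↦ a ∧ ω` by a `1`-covector `a`, that is
`(a ∧ ω)(v₀, …, v_k) = ∑ i, (-1)ⁱ a(v_i) ω(v₀, …, v̂_i, …, v_k)`. -/
def wedge {n : ℕ} (k : ℕ) (a : Pt n →L[ℝ] ℝ) : Cov n k →L[ℝ] Cov n (k + 1) :=
  (ContinuousAlternatingMap.alternatizeUncurryFinCLM ℝ (Pt n) ℝ).comp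
    (ContinuousLinearMap.smulRightL ℝ (Pt n) (Cov n k) a)

/-- Exterior multiplication `ω ↦ dθ ∧ ω`, where `dθ = -∑ dx_j ∧ dy_j`. -/
def wedgeDTheta (n k : ℕ) : Cov n k →L[ℝ] Cov n (k + 2) :=
  -∑ j, (wedge (k + 1) (dx j)).comp (wedge k (dy j))

/-- The fibre at `p` of `I^k = {α ∧ θ + β ∧ dθ}`. -/
def fibreI {n : ℕ} (p : Pt n) : (k : ℕ) → Submodule ℝ (Cov n k)
  | 0 => ⊥
  | 1 => LinearMap.range (wedge 0 (theta p)).toLinearMap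
  | k + 2 => LinearMap.range (wedge (k + 1) (theta p)).toLinearMap ⊔
      LinearMap.range (wedgeDTheta n k).toLinearMap

/-- The fibre at `p` of `J^k = {ω | ω ∧ θ = 0, ω ∧ dθ = 0}`. -/
def fibreJ {n : ℕ} (p : Pt n) (k : ℕ) : Submodule ℝ (Cov n k) :=
  LinearMap.ker (wedge k (theta p)).toLinearMap ⊓ LinearMap.ker (wedgeDTheta n k).toLinearMap

/-- The inner product on `k`-covectors at `p` for which the coframe dual to `frame p`
induces an orthonormal basis. (The sum runs over all tuples, whence the factor `1 / k!`.) -/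
def covInner {n k : ℕ} (p : Pt n) (ω η : Cov n k) : ℝ :=
  (1 / (k.factorial : ℝ)) * ∑ i : Fin k → Fin n ⊕ Fin n ⊕ Unit,
    ω (fun l => frame p (i l)) * η (fun l => frame p (i l))

/-- The norm `|v|` on `k`-vectors at `p` dual to the Euclidean norm of `covInner p`. -/
def vecNorm {n k : ℕ} (p : Pt n) (v : Vec n k) : ℝ :=
  sSup {r : ℝ | ∃ ω : Cov n k, covInner p ω ω ≤ 1 ∧ r = v ω}

/-- The Heisenberg `k`-vectors at `p`: for `k ≤ n` those that annihilate `I^k`, for `k > n`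
those that are metrically dual to the elements of `J^k`. -/
def IsHVec {n k : ℕ} (p : Pt n) (v : Vec n k) : Prop :=
  (k ≤ n → ∀ ω ∈ fibreI p k, v ω = 0) ∧
  (n < k → ∃ η ∈ fibreJ p k, ∀ ω, v ω = covInner p η ω)

/-- The comass `‖ω‖*` at `p`. -/
def comass {n k : ℕ} (p : Pt n) (ω : Cov n k) : ℝ :=
  sSup {r : ℝ | ∃ v : Vec n k, IsHVec p v ∧ vecNorm p v ≤ 1 ∧ r = v ω}

/-! ### The Rumin complex with compact supports -/

/-- Smooth `k`-forms with compact support in `U`, with the usual LF topology. -/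
abbrev TestForm {n : ℕ} (U : Opens (Pt n)) (k : ℕ) : Type := 𝓓(U, Cov n k)

/-- The exterior derivative on test forms, `ω ↦ extDeriv ω` (see `extD_apply`). -/
def extD {n : ℕ} (U : Opens (Pt n)) (k : ℕ) : TestForm U k →L[ℝ] TestForm U (k + 1) :=
  (TestFunction.postcompCLM
    (ContinuousAlternatingMap.alternatizeUncurryFinCLM ℝ (Pt n) ℝ)).comp
    (TestFunction.fderivCLM ℝ ⊤ ⊤)

theorem extD_apply {n : ℕ} {U : Opens (Pt n)} {k : ℕ} (ω : TestForm U k) (p : Pt n) :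
    extD U k ω p = extDeriv ω p := by
  simp [extD, extDeriv]

/-- Test forms with values in `I^k`. -/
def formsI {n : ℕ} (U : Opens (Pt n)) (k : ℕ) : Submodule ℝ (TestForm U k) where
  carrier := {ω | ∀ p, ω p ∈ fibreI p k}
  zero_mem' := fun p => by simp
  add_mem' := fun {a b} ha hb p => by simpa using add_mem (ha p) (hb p)
  smul_mem' := fun c a ha p => by simpa using Submodule.smul_mem _ c (ha p)

/-- Test forms with values in `J^k`. -/
def formsJ {n : ℕ} (U : Opens (Pt n)) (k : ℕ) : Submodule ℝ (TestForm U k) where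
  carrier := {ω | ∀ p, ω p ∈ fibreJ p k}
  zero_mem' := fun p => by simp
  add_mem' := fun {a b} ha hb p => by simpa using add_mem (ha p) (hb p)
  smul_mem' := fun c a ha p => by simpa using Submodule.smul_mem _ c (ha p)

/-- The test forms that represent Rumin forms: all of them for `k ≤ n`, those in `J^k` for
`k > n`. -/
def reps {n : ℕ} (U : Opens (Pt n)) (k : ℕ) : Submodule ℝ (TestForm U k) :=
  if k ≤ n then ⊤ else formsJ U k

/-- The test forms that represent zero: those in `I^k` for `k ≤ n`, only `0` for `k > n`. -/
def nulls {n : ℕ} (U : Opens (Pt n)) (k : ℕ) : Submodule ℝ (TestForm U k) :=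
  if k ≤ n then formsI U k else ⊥

/-- The space `𝒟^k_ℍ(U)` of compactly supported Rumin forms with its natural topology:
`Ω^k / I^k` for `k ≤ n` and `J^k` for `k > n`. -/
abbrev RForm {n : ℕ} (U : Opens (Pt n)) (k : ℕ) : Type :=
  ↥(reps U k) ⧸ (nulls U k).submoduleOf (reps U k)

/-- The Rumin form represented by a test form. -/
def cls {n : ℕ} {U : Opens (Pt n)} {k : ℕ} (ω : reps U k) : RForm U k :=
  Submodule.Quotient.mk ω

/-- `D` is the Rumin differential `d_c` in degree `k`.
* For `k < n`, `D [ω] = [dω]`.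
* For `k = n`, `D [ω] = d(ω + γ)`, where `γ` is the vertical form (a multiple of `θ`, that is
  `θ ∧ γ = 0`) for which `d(ω + γ)` has no horizontal part (that is `θ ∧ d(ω + γ) = 0`).
  Writing `γ = θ ∧ β` with `β` horizontal, the horizontal part of `d(ω + γ)` is that of
  `dω` plus `dθ ∧ β`, so that `β = L⁻¹(-(dω)_h)` for the isomorphism `L β = dθ ∧ β` from
  horizontal `(n - 1)`-covectors onto horizontal `(n + 1)`-covectors.
* For `k > n`, `D ω = dω`. -/
structure IsRuminDifferential {n : ℕ} (U : Opens (Pt n)) (k : ℕ)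
    (D : RForm U k →L[ℝ] RForm U (k + 1)) : Prop where
  spec_lt : k < n → ∀ ω : reps U k, ∃ η : reps U (k + 1),
    (η : TestForm U (k + 1)) = extD U k ω ∧ D (cls ω) = cls η
  spec_eq : k = n → ∀ ω : reps U k, ∃ (γ : TestForm U k) (η : reps U (k + 1)),
    (∀ p, wedge k (theta p) (γ p) = 0) ∧
    (∀ p, wedge (k + 1) (theta p) (extD U k (ω + γ) p) = 0) ∧
    (η : TestForm U (k + 1)) = extD U k (ω + γ) ∧ D (cls ω) = cls η
  spec_gt : n < k → ∀ ω : reps U k, ∃ η : reps U (k + 1),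
    (η : TestForm U (k + 1)) = extD U k ω ∧ D (cls ω) = cls η

open Classical in
/-- The Rumin differential `d_c : 𝒟^k_ℍ(U) → 𝒟^{k+1}_ℍ(U)`, the unique operator with the
property `IsRuminDifferential`. -/
def dc {n : ℕ} (U : Opens (Pt n)) (k : ℕ) : RForm U k →L[ℝ] RForm U (k + 1) :=
  if h : ∃ D, IsRuminDifferential U k D then h.choose else 0

/-! ### Heisenberg currents -/

/-- Heisenberg `k`-currents: continuous linear functionals on `𝒟^k_ℍ(U)`. -/
abbrev Current {n : ℕ} (U : Opens (Pt n)) (k : ℕ) : Type := RForm U k →L[ℝ] ℝ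

/-- The boundary `(∂T)(ω) = T(d_c ω)`. Currents of dimension `0` have boundary zero
(recorded in dimension `0 - 1 = 0`). -/
def bdry {n : ℕ} {U : Opens (Pt n)} : {k : ℕ} → Current U k → Current U (k - 1)
  | 0, _ => 0
  | k + 1, T => T.comp (dc U k)

/-- The support of a current, a relatively closed subset of `U`. -/
def spt {n : ℕ} {U : Opens (Pt n)} {k : ℕ} (T : Current U k) : Set (Pt n) :=
  {p | p ∈ U ∧ ∀ V : Set (Pt n), IsOpen V → p ∈ V →
    ∃ ω : reps U k, tsupport (ω : TestForm U k) ⊆ V ∧ T (cls ω) ≠ 0}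

/-- The mass `M(T) = sup {T(ω) | ‖ω‖* ≤ 1}`. -/
def mass {n : ℕ} {U : Opens (Pt n)} {k : ℕ} (T : Current U k) : ENNReal :=
  ⨆ (ω : reps U k) (_ : ∀ p, comass p ((ω : TestForm U k) p) ≤ 1), ENNReal.ofReal (T (cls ω))

/-- A representation of `T` by integration, `T(ω) = ∫_U ⟨ω | τ⟩ dμ`: here `μ` is a Radon
measure on `U` (a Borel measure on the ambient space that is carried by `U` and finite on the
compact subsets of `U`) and `τ` is a `μ`-measurable field of Heisenberg `k`-vectors with
`|τ| = 1` almost everywhere. -/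
structure IntegralRep {n : ℕ} {U : Opens (Pt n)} {k : ℕ} (T : Current U k) where
  /-- the measure -/
  μ : Measure (Pt n)
  /-- the field of `k`-vectors -/
  τ : Pt n → Vec n k
  carried : μ (U : Set (Pt n))ᶜ = 0
  finite_compact : ∀ K : Set (Pt n), IsCompact K → K ⊆ U → μ K < ⊤
  measurable : AEStronglyMeasurable τ μ
  isHVec : ∀ᵐ p ∂μ, IsHVec p (τ p)
  norm_one : ∀ᵐ p ∂μ, vecNorm p (τ p) = 1
  repr : ∀ ω : reps U k, T (cls ω) = ∫ p, τ p ((ω : TestForm U k) p) ∂μ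

/-- Currents representable by integration. -/
def IsRepresentable {n : ℕ} {U : Opens (Pt n)} {k : ℕ} (T : Current U k) : Prop :=
  Nonempty (IntegralRep T)

/-- Normal currents: `T` and `∂T` are representable by integration and have finite mass. -/
structure IsNormal {n : ℕ} {U : Opens (Pt n)} {k : ℕ} (T : Current U k) : Prop where
  representable : IsRepresentable T
  representable_bdry : IsRepresentable (bdry T)
  mass_lt_top : mass T < ⊤
  mass_bdry_lt_top : mass (bdry T) < ⊤

open Classical in
/-- The measure `μ_T` of a current that is representable by integration. -/
def curMeasure {n : ℕ} {U : Opens (Pt n)} {k : ℕ} (T : Current U k) : Measure (Pt n) :=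
  if h : IsRepresentable T then h.some.μ else 0

/-- The functional `ω ↦ ∫_A ⟨ω | τ⟩ dμ` on test forms. -/
def IntegralRep.onForms {n : ℕ} {U : Opens (Pt n)} {k : ℕ} {T : Current U k}
    (R : IntegralRep T) (A : Set (Pt n)) : reps U k →L[ℝ] ℝ :=
  (TestFunction.integralAgainstBilinCLM (ContinuousLinearMap.apply ℝ ℝ)
    (R.μ.restrict A) R.τ).comp (reps U k).subtypeL

theorem IntegralRep.onForms_eq_zero {n : ℕ} {U : Opens (Pt n)} {k : ℕ} {T : Current U k}
    (R : IntegralRep T) (A : Set (Pt n)) (ω : reps U k)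
    (hω : ω ∈ (nulls U k).submoduleOf (reps U k)) : R.onForms A ω = 0 := by
  have h0 : (ω : TestForm U k) ∈ nulls U k := hω
  have key : ∀ᵐ p ∂(R.μ.restrict A), R.τ p ((ω : TestForm U k) p) = 0 := by
    refine ae_restrict_of_ae ?_
    filter_upwards [R.isHVec] with p hp
    unfold nulls at h0
    split_ifs at h0 with hk
    · exact hp.1 hk _ (h0 p)
    · have : (ω : TestForm U k) = 0 := by simpa using h0
      simp [this]
  have hint : ∫ p, R.τ p ((ω : TestForm U k) p) ∂(R.μ.restrict A) = 0 :=
    integral_eq_zero_of_ae key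
  simp [onForms, hint]

/-- The current `ω ↦ ∫_A ⟨ω | τ⟩ dμ`. -/
def IntegralRep.restrict {n : ℕ} {U : Opens (Pt n)} {k : ℕ} {T : Current U k}
    (R : IntegralRep T) (A : Set (Pt n)) : Current U k where
  toLinearMap := Submodule.liftQ _ (R.onForms A).toLinearMap
    (fun ω hω => R.onForms_eq_zero A ω hω)
  cont := (R.onForms A).continuous.quotient_lift _

open Classical in
/-- The restriction `(T ⌞ A)(ω) = ∫_A ⟨ω | τ⟩ dμ_T` of a current that is representable by
integration to a Borel set `A`. -/
def res {n : ℕ} {U : Opens (Pt n)} {k : ℕ} (T : Current U k) (A : Set (Pt n)) : Current U k :=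
  if h : IsRepresentable T then h.some.restrict A else 0

/-- The slice `⟨T, f, t+⟩ = (∂T) ⌞ {f > t} - ∂(T ⌞ {f > t})`. -/
def sliceRight {n : ℕ} {U : Opens (Pt n)} {k : ℕ} (T : Current U k) (f : Pt n → ℝ) (t : ℝ) :
    Current U (k - 1) :=
  res (bdry T) {p | p ∈ U ∧ t < f p} - bdry (res T {p | p ∈ U ∧ t < f p})

/-- The slice `⟨T, f, t-⟩ = ∂(T ⌞ {f < t}) - (∂T) ⌞ {f < t}`. -/
def sliceLeft {n : ℕ} {U : Opens (Pt n)} {k : ℕ} (T : Current U k) (f : Pt n → ℝ) (t : ℝ) :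
    Current U (k - 1) :=
  bdry (res T {p | p ∈ U ∧ f p < t}) - res (bdry T) {p | p ∈ U ∧ f p < t}

end Heis

end

noncomputable section

namespace Heis

/-! ### Exterior multiplication and contraction -/

theorem wedge_apply {n k : ℕ} (a : Pt n →L[ℝ] ℝ) (ω : Cov n k) (v : Fin (k + 1) → Pt n) :
    wedge k a ω v = ∑ i : Fin (k + 1), (-1) ^ (i : ℕ) * (a (v i) * ω (i.removeNth v)) := by
  simp [wedge, ContinuousAlternatingMap.alternatizeUncurryFin_apply]

/-- Exterior multiplication as a bilinear map. -/
def wedgeL (n k : ℕ) : (Pt n →L[ℝ] ℝ) →L[ℝ] Cov n k →L[ℝ] Cov n (k + 1) :=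
  (ContinuousLinearMap.compL ℝ (Cov n k) (Pt n →L[ℝ] Cov n k) (Cov n (k + 1))
    (ContinuousAlternatingMap.alternatizeUncurryFinCLM ℝ (Pt n) ℝ)).comp
    (ContinuousLinearMap.smulRightL ℝ (Pt n) (Cov n k))

theorem wedgeL_apply {n k : ℕ} (a : Pt n →L[ℝ] ℝ) : wedgeL n k a = wedge k a := rfl

theorem alternatizeUncurryFin_smulRight_anticomm {E : Type*} [NormedAddCommGroup E]
    [NormedSpace ℝ E] {k : ℕ} (a b : E →L[ℝ] ℝ) (ω : E [⋀^Fin k]→L[ℝ] ℝ) :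
    ContinuousAlternatingMap.alternatizeUncurryFin
        (a.smulRight (ContinuousAlternatingMap.alternatizeUncurryFin (b.smulRight ω))) =
      -ContinuousAlternatingMap.alternatizeUncurryFin
        (b.smulRight (ContinuousAlternatingMap.alternatizeUncurryFin (a.smulRight ω))) := by
  let g (a b : E →L[ℝ] ℝ) : E →L[ℝ] E →L[ℝ] E [⋀^Fin k]→L[ℝ] ℝ := a.smulRight (b.smulRight ω)
  have hg (a b : E →L[ℝ] ℝ) : a.smulRight
        (ContinuousAlternatingMap.alternatizeUncurryFin (b.smulRight ω)) =
      (ContinuousAlternatingMap.alternatizeUncurryFinCLM ℝ E ℝ).comp (g a b) := by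
    ext1 x
    simp [g]
  ext v
  rw [hg, hg, ContinuousAlternatingMap.neg_apply,
    ContinuousAlternatingMap.alternatizeUncurryFin_alternatizeUncurryFinCLM_comp_apply,
    ContinuousAlternatingMap.alternatizeUncurryFin_alternatizeUncurryFinCLM_comp_apply,
    ← Finset.sum_neg_distrib]
  refine Finset.sum_congr rfl fun i _ => ?_
  rw [← Finset.sum_neg_distrib]
  refine Finset.sum_congr rfl fun j _ => ?_
  rw [← smul_neg]
  congr 1
  simp only [g, ContinuousLinearMap.smulRight_apply, smul_apply,
    ContinuousAlternatingMap.smul_apply, smul_eq_mul]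
  ring

theorem wedge_anticomm {n k : ℕ} (a b : Pt n →L[ℝ] ℝ) (ω : Cov n k) :
    wedge (k + 1) a (wedge k b ω) = -wedge (k + 1) b (wedge k a ω) :=
  alternatizeUncurryFin_smulRight_anticomm a b ω

theorem wedge_self {n k : ℕ} (a : Pt n →L[ℝ] ℝ) (ω : Cov n k) :
    wedge (k + 1) a (wedge k a ω) = 0 := by
  have h := wedge_anticomm a a ω
  rw [eq_neg_iff_add_eq_zero, ← two_smul ℝ] at h
  exact (smul_eq_zero.mp h).resolve_left two_ne_zero

/-- The contraction `ω ↦ ι_v ω` of a covector with a vector. -/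
def contr {n : ℕ} (k : ℕ) (v : Pt n) : Cov n (k + 1) →L[ℝ] Cov n k :=
  (ContinuousLinearMap.apply ℝ (Cov n k) v).comp
    (ContinuousAlternatingMap.curryLeftLI (𝕜 := ℝ) (E := Pt n) (F := ℝ)
      (n := k)).toContinuousLinearMap

theorem contr_apply {n k : ℕ} (v : Pt n) (ω : Cov n (k + 1)) (w : Fin k → Pt n) :
    contr k v ω w = ω (Matrix.vecCons v w) := rfl

theorem contr_wedge_zero {n : ℕ} (v : Pt n) (a : Pt n →L[ℝ] ℝ) (ω : Cov n 0) :
    contr 0 v (wedge 0 a ω) = a v • ω := by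
  ext w
  rw [contr_apply, wedge_apply]
  simp [Subsingleton.elim (Fin.removeNth 0 (Matrix.vecCons v w)) w]

theorem contr_wedge {n k : ℕ} (v : Pt n) (a : Pt n →L[ℝ] ℝ) (ω : Cov n (k + 1)) :
    contr (k + 1) v (wedge (k + 1) a ω) = a v • ω - wedge k a (contr k v ω) := by
  ext w
  rw [contr_apply, wedge_apply, Fin.sum_univ_succ]
  simp only [ContinuousAlternatingMap.sub_apply, ContinuousAlternatingMap.smul_apply, wedge_apply,
    contr_apply, Fin.val_zero, pow_zero, one_mul, Matrix.cons_val_zero, Matrix.cons_val_succ,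
    Fin.val_succ, pow_succ, smul_eq_mul]
  rw [sub_eq_add_neg, ← Finset.sum_neg_distrib]
  congr 1
  refine Finset.sum_congr rfl fun i _ => ?_
  have : (i.succ.removeNth (Matrix.vecCons v w) : Fin (k + 1) → Pt n) =
      Matrix.vecCons v (i.removeNth w) := by
    ext1 j
    refine Fin.cases ?_ (fun j => ?_) j <;> simp [Fin.removeNth]
  rw [this]
  ring

/-! ### The induced inner product -/

theorem covInner_self_nonneg {n k : ℕ} (p : Pt n) (ω : Cov n k) : 0 ≤ covInner p ω ω :=
  mul_nonneg (by positivity) (Finset.sum_nonneg fun _ _ => mul_self_nonneg _)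

/-- The left-invariant frame at the origin, as a basis. -/
def stdBasis (n : ℕ) : Module.Basis (Fin n ⊕ Fin n ⊕ Unit) ℝ (Pt n) :=
  (Pi.basisFun ℝ (Fin n)).prod ((Pi.basisFun ℝ (Fin n)).prod (Module.Basis.singleton Unit ℝ))

theorem stdBasis_apply {n : ℕ} (i : Fin n ⊕ Fin n ⊕ Unit) : stdBasis n i = frame 0 i := by
  rcases i with j | j | j <;> simp [stdBasis, frame, Module.Basis.prod_apply, Prod.ext_iff]

theorem eq_zero_of_covInner_self_eq_zero {n k : ℕ} {ω : Cov n k} (h : covInner 0 ω ω = 0) :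
    ω = 0 := by
  have hk : (1 / (k.factorial : ℝ)) ≠ 0 := by positivity
  have h0 := (mul_eq_zero.mp h).resolve_left hk
  rw [Finset.sum_eq_zero_iff_of_nonneg fun _ _ => mul_self_nonneg _] at h0
  apply ContinuousAlternatingMap.toAlternatingMap_injective
  refine Module.Basis.ext_alternating (stdBasis n) fun v _ => ?_
  have := mul_self_eq_zero.mp (h0 v (Finset.mem_univ _))
  simpa [stdBasis_apply] using this

theorem covInner_wedge_left {n k : ℕ} (p : Pt n) (a : Pt n →L[ℝ] ℝ) (v : Pt n)
    (hv : ∑ i, a (frame p i) • frame p i = v) (ω : Cov n k) (η : Cov n (k + 1)) :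
    covInner p (wedge k a ω) η = covInner p ω (contr k v η) := by
  have hl (l : Fin (k + 1)) : ∑ i : Fin (k + 1) → Fin n ⊕ Fin n ⊕ Unit,
      (-1) ^ (l : ℕ) * (a (frame p (i l)) * ω (l.removeNth fun m => frame p (i m))) *
        η (fun m => frame p (i m)) =
      ∑ i : Fin k → Fin n ⊕ Fin n ⊕ Unit,
        ω (fun m => frame p (i m)) * contr k v η (fun m => frame p (i m)) := by
    rw [← (Fin.insertNthEquiv (fun _ => Fin n ⊕ Fin n ⊕ Unit) l).sum_comp,
      Fintype.sum_prod_type, Finset.sum_comm]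
    refine Finset.sum_congr rfl fun i _ => ?_
    have h1 (x : Fin n ⊕ Fin n ⊕ Unit) : (fun m => frame p (l.insertNth (α := fun _ => _) x i m)) =
        l.insertNth (α := fun _ => Pt n) (frame p x) (fun m => frame p (i m)) := by
      ext1 m
      refine Fin.succAboveCases l ?_ (fun m => ?_) m <;> simp
    have h2 : contr k v η (fun m => frame p (i m)) =
        ∑ x, a (frame p x) * η (Matrix.vecCons (frame p x) (fun m => frame p (i m))) := by
      rw [← hv, contr]
      simp
    rw [h2, Finset.mul_sum]
    refine Finset.sum_congr rfl fun x _ => ?_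
    simp only [Fin.insertNthEquiv_apply]
    rw [h1, ContinuousAlternatingMap.map_insertNth]
    simp only [Fin.insertNth_apply_same, Fin.removeNth_insertNth, zsmul_eq_mul]
    push_cast
    have : ((-1 : ℝ) ^ (l : ℕ)) * (-1) ^ (l : ℕ) = 1 := by rw [← mul_pow]; simp
    linear_combination (a (frame p x) * ω (fun m => frame p (i m)) *
      η (Matrix.vecCons (frame p x) (fun m => frame p (i m)))) * this
  unfold covInner
  simp only [wedge_apply, Finset.sum_mul]
  rw [Finset.sum_comm]
  simp only [hl]
  simp only [Finset.sum_const, Finset.card_univ, Fintype.card_fin, nsmul_eq_mul, Nat.factorial_succ]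
  push_cast
  have : (k.factorial : ℝ) ≠ 0 := by positivity
  field_simp

theorem sum_covInner_contr {n k : ℕ} (p : Pt n) (ω : Cov n (k + 1)) :
    ∑ i, covInner p (contr k (frame p i) ω) (contr k (frame p i) ω) =
      (k + 1) * covInner p ω ω := by
  have : ∑ i : Fin (k + 1) → Fin n ⊕ Fin n ⊕ Unit,
      ω (fun m => frame p (i m)) * ω (fun m => frame p (i m)) =
      ∑ x, ∑ i : Fin k → Fin n ⊕ Fin n ⊕ Unit, contr k (frame p x) ω (fun m => frame p (i m)) *
        contr k (frame p x) ω (fun m => frame p (i m)) := by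
    rw [← (Fin.consEquiv (fun _ => Fin n ⊕ Fin n ⊕ Unit)).sum_comp, Fintype.sum_prod_type]
    refine Finset.sum_congr rfl fun x _ => Finset.sum_congr rfl fun i _ => ?_
    have h1 : (fun m => frame p (Fin.cons (α := fun _ => _) x i m)) =
        Matrix.vecCons (frame p x) (fun m => frame p (i m)) := by
      ext1 m
      refine Fin.cases ?_ (fun m => ?_) m <;> simp
    simp only [Fin.consEquiv_apply, contr_apply]
    rw [h1]
  unfold covInner
  rw [this, ← Finset.mul_sum, Nat.factorial_succ]
  push_cast
  have : (k.factorial : ℝ) ≠ 0 := by positivity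
  field_simp

/-! ### The Lefschetz operators on horizontal covectors -/

/-- Families consisting of a covector in every degree. -/
abbrev GradedCov (n : ℕ) : Type := (k : ℕ) → Cov n k

/-- Exterior multiplication by a `1`-covector in all degrees. -/
def extMul {n : ℕ} (a : Pt n →L[ℝ] ℝ) : Module.End ℝ (GradedCov n) where
  toFun ω
    | 0 => 0
    | k + 1 => wedge k a (ω k)
  map_add' ω η := by
    ext1 k
    cases k <;> simp
  map_smul' c ω := by
    ext1 k
    cases k <;> simp

/-- Contraction with a vector in all degrees. -/
def intMul {n : ℕ} (v : Pt n) : Module.End ℝ (GradedCov n) where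
  toFun ω k := contr k v (ω (k + 1))
  map_add' ω η := by
    ext1 k
    simp
  map_smul' c ω := by
    ext1 k
    simp

theorem extMul_zero {n : ℕ} (a : Pt n →L[ℝ] ℝ) (ω : GradedCov n) : extMul a ω 0 = 0 := rfl

theorem extMul_succ {n : ℕ} (a : Pt n →L[ℝ] ℝ) (ω : GradedCov n) (k : ℕ) :
    extMul a ω (k + 1) = wedge k a (ω k) := rfl

theorem intMul_apply {n : ℕ} (v : Pt n) (ω : GradedCov n) (k : ℕ) :
    intMul v ω k = contr k v (ω (k + 1)) := rfl

theorem intMul_extMul {n : ℕ} (v : Pt n) (a : Pt n →L[ℝ] ℝ) (ω : GradedCov n) :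
    intMul v (extMul a ω) = a v • ω - extMul a (intMul v ω) := by
  refine funext fun k => ?_
  cases k with
  | zero =>
    change contr 0 v (wedge 0 a (ω 0)) = a v • ω 0 - 0
    rw [contr_wedge_zero, sub_zero]
  | succ k => exact contr_wedge v a (ω (k + 1))

/-- The vector `X_j` at the origin. -/
def vecX {n : ℕ} (j : Fin n) : Pt n := frame 0 (.inl j)

/-- The vector `Y_j` at the origin. -/
def vecY {n : ℕ} (j : Fin n) : Pt n := frame 0 (.inr (.inl j))

/-- The Reeb vector `∂_t`. -/
def vecT {n : ℕ} : Pt n := (0, 0, 1)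

theorem frame_zero_inr_inr {n : ℕ} (u : Unit) : frame (0 : Pt n) (.inr (.inr u)) = vecT := rfl

theorem dx_vecX {n : ℕ} (i j : Fin n) : dx i (vecX j) = if i = j then 1 else 0 := by
  simp [dx, vecX, frame, Pi.single_apply]

theorem dx_vecY {n : ℕ} (i j : Fin n) : dx i (vecY j) = 0 := by
  simp [dx, vecY, frame]

theorem dx_vecT {n : ℕ} (i : Fin n) : dx i vecT = 0 := by
  simp [dx, vecT]

theorem dy_vecX {n : ℕ} (i j : Fin n) : dy i (vecX j) = 0 := by
  simp [dy, vecX, frame]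

theorem dy_vecY {n : ℕ} (i j : Fin n) : dy i (vecY j) = if i = j then 1 else 0 := by
  simp [dy, vecY, frame, Pi.single_apply]

theorem dy_vecT {n : ℕ} (i : Fin n) : dy i vecT = 0 := by
  simp [dy, vecT]

theorem sum_dx_frame {n : ℕ} (j : Fin n) :
    ∑ i, dx j (frame (0 : Pt n) i) • frame (0 : Pt n) i = vecX j := by
  have hX (i : Fin n) : frame (0 : Pt n) (.inl i) = vecX i := rfl
  have hY (i : Fin n) : frame (0 : Pt n) (.inr (.inl i)) = vecY i := rfl
  simp [Fintype.sum_sum_type, hX, hY, frame_zero_inr_inr, dx_vecX, dx_vecY, dx_vecT]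

theorem sum_dy_frame {n : ℕ} (j : Fin n) :
    ∑ i, dy j (frame (0 : Pt n) i) • frame (0 : Pt n) i = vecY j := by
  have hX (i : Fin n) : frame (0 : Pt n) (.inl i) = vecX i := rfl
  have hY (i : Fin n) : frame (0 : Pt n) (.inr (.inl i)) = vecY i := rfl
  simp [Fintype.sum_sum_type, hX, hY, frame_zero_inr_inr, dy_vecX, dy_vecY, dy_vecT]

/-- The Lefschetz operator `ω ↦ ∑ dx_j ∧ dy_j ∧ ω`. -/
def lef (n : ℕ) : Module.End ℝ (GradedCov n) := ∑ j, extMul (dx j) * extMul (dy j)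

/-- The adjoint of the Lefschetz operator. -/
def lefDual (n : ℕ) : Module.End ℝ (GradedCov n) := ∑ j, intMul (vecY j) * intMul (vecX j)

theorem lef_apply_add_two {n : ℕ} (ω : GradedCov n) (k : ℕ) :
    lef n ω (k + 2) = -wedgeDTheta n k (ω k) := by
  simp [lef, wedgeDTheta, extMul_succ]

theorem lefschetz_commutator {V : Type*} [AddCommGroup V] [Module ℝ V] {n : ℕ}
    (e f a b : Fin n → V →ₗ[ℝ] V)
    (hae : ∀ i j x, a i (e j x) = (if j = i then 1 else 0 : ℝ) • x - e j (a i x))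
    (haf : ∀ i j x, a i (f j x) = -f j (a i x))
    (hbe : ∀ i j x, b i (e j x) = -e j (b i x))
    (hbf : ∀ i j x, b i (f j x) = (if j = i then 1 else 0 : ℝ) • x - f j (b i x)) (x : V) :
    ∑ i, b i (a i (∑ j, e j (f j x))) =
      ∑ j, e j (f j (∑ i, b i (a i x))) + (n : ℝ) • x -
        ∑ j, (f j (b j x) + e j (a j x)) := by
  have hij (i j : Fin n) : b i (a i (e j (f j x))) = e j (f j (b i (a i x))) +
      if j = i then x - (f j (b i x) + e j (a i x)) else 0 := by
    rw [hae, haf]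
    by_cases h : j = i
    · simp only [h, if_true, one_smul, map_neg, sub_neg_eq_add, map_add, hbf, hbe, map_sub]
      abel
    · simp only [h, if_false, zero_smul, map_neg, zero_sub, neg_neg, hbe, hbf, add_zero]
  simp only [map_sum, hij, Finset.sum_add_distrib, Finset.sum_ite_eq', Finset.mem_univ, if_true,
    Finset.sum_sub_distrib]
  rw [Finset.sum_comm, Finset.sum_const, Finset.card_univ, Fintype.card_fin,
    ← Nat.cast_smul_eq_nsmul ℝ]
  abel

theorem lefDual_lef {n : ℕ} (ω : GradedCov n) (k : ℕ) :
    lefDual n (lef n ω) k = lef n (lefDual n ω) k + (n : ℝ) • ω k -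
      ∑ j, (extMul (dy j) (intMul (vecY j) ω) k + extMul (dx j) (intMul (vecX j) ω) k) := by
  have h := lefschetz_commutator (fun j : Fin n => extMul (dx j)) (fun j => extMul (dy j))
    (fun j => intMul (vecX j)) (fun j => intMul (vecY j))
    (fun i j x => by rw [← dx_vecX]; exact intMul_extMul _ _ _)
    (fun i j x => by simpa [dy_vecX] using intMul_extMul (vecX i) (dy j) x)
    (fun i j x => by simpa [dx_vecY] using intMul_extMul (vecY i) (dx j) x)
    (fun i j x => by rw [← dy_vecY]; exact intMul_extMul _ _ _) ω
  have h' := congrFun h k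
  simp only [lef, lefDual, LinearMap.sum_apply, Module.End.mul_apply]
  rw [h']
  simp [Finset.sum_apply]

theorem covInner_comm {n k : ℕ} (p : Pt n) (ω η : Cov n k) : covInner p ω η = covInner p η ω := by
  simp only [covInner, mul_comm (ω _)]

theorem covInner_add_left {n k : ℕ} (p : Pt n) (ω₁ ω₂ η : Cov n k) :
    covInner p (ω₁ + ω₂) η = covInner p ω₁ η + covInner p ω₂ η := by
  simp [covInner, add_mul, Finset.sum_add_distrib, mul_add]

theorem covInner_smul_left {n k : ℕ} (p : Pt n) (c : ℝ) (ω η : Cov n k) :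
    covInner p (c • ω) η = c * covInner p ω η := by
  simp only [covInner, ContinuousAlternatingMap.smul_apply, smul_eq_mul, mul_assoc,
    ← Finset.mul_sum]
  ring

/-- `covInner` as a linear map of its first argument. -/
def covInnerLeft {n k : ℕ} (p : Pt n) (η : Cov n k) : Cov n k →ₗ[ℝ] ℝ where
  toFun ω := covInner p ω η
  map_add' ω₁ ω₂ := covInner_add_left p ω₁ ω₂ η
  map_smul' c ω := covInner_smul_left p c ω η

theorem covInner_sub_left {n k : ℕ} (p : Pt n) (ω₁ ω₂ η : Cov n k) :
    covInner p (ω₁ - ω₂) η = covInner p ω₁ η - covInner p ω₂ η :=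
  map_sub (covInnerLeft p η) ω₁ ω₂

theorem covInner_sum_left {n k : ℕ} {ι : Type*} (s : Finset ι) (p : Pt n) (ω : ι → Cov n k)
    (η : Cov n k) : covInner p (∑ i ∈ s, ω i) η = ∑ i ∈ s, covInner p (ω i) η :=
  map_sum (covInnerLeft p η) ω s

theorem covInner_zero_left {n k : ℕ} (p : Pt n) (η : Cov n k) : covInner p 0 η = 0 :=
  map_zero (covInnerLeft p η)

theorem covInner_extMul_dx {n k : ℕ} (j : Fin n) (ω η : GradedCov n) :
    covInner 0 (extMul (dx j) ω (k + 1)) (η (k + 1)) =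
      covInner 0 (ω k) (intMul (vecX j) η k) :=
  covInner_wedge_left 0 (dx j) (vecX j) (sum_dx_frame j) (ω k) (η (k + 1))

theorem covInner_extMul_dy {n k : ℕ} (j : Fin n) (ω η : GradedCov n) :
    covInner 0 (extMul (dy j) ω (k + 1)) (η (k + 1)) =
      covInner 0 (ω k) (intMul (vecY j) η k) :=
  covInner_wedge_left 0 (dy j) (vecY j) (sum_dy_frame j) (ω k) (η (k + 1))

theorem covInner_lef {n k : ℕ} (ω η : GradedCov n) :
    covInner 0 (lef n ω (k + 2)) (η (k + 2)) = covInner 0 (ω k) (lefDual n η k) := by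
  rw [covInner_comm 0 (ω k)]
  simp only [lef, lefDual, LinearMap.sum_apply, Finset.sum_apply, Module.End.mul_apply]
  rw [covInner_sum_left, covInner_sum_left]
  refine Finset.sum_congr rfl fun j _ => ?_
  rw [covInner_extMul_dx, covInner_extMul_dy, covInner_comm]

theorem covInner_lef_lefDual_nonneg {n k : ℕ} (ω : GradedCov n) :
    0 ≤ covInner 0 (lef n (lefDual n ω) k) (ω k) := by
  match k with
  | 0 =>
    have : lef n (lefDual n ω) 0 = 0 := by simp [lef, extMul_zero]
    rw [this, covInner_zero_left]
  | 1 =>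
    have : lef n (lefDual n ω) 1 = 0 := by simp [lef, extMul_succ, extMul_zero]
    rw [this, covInner_zero_left]
  | k + 2 =>
    rw [covInner_lef]
    exact covInner_self_nonneg 0 _

theorem sum_covInner_number {n k : ℕ} (ω : GradedCov n) :
    ∑ j, covInner 0
      (extMul (dy j) (intMul (vecY j) ω) (k + 1) + extMul (dx j) (intMul (vecX j) ω) (k + 1))
      (ω (k + 1)) + covInner 0 (intMul vecT ω k) (intMul vecT ω k) =
      (k + 1) * covInner 0 (ω (k + 1)) (ω (k + 1)) := by
  rw [← sum_covInner_contr, Fintype.sum_sum_type, Fintype.sum_sum_type]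
  simp only [covInner_add_left,
    covInner_extMul_dy, covInner_extMul_dx, Finset.sum_add_distrib, Finset.univ_unique,
    Finset.sum_singleton, frame_zero_inr_inr]
  rw [add_comm (∑ j, covInner 0 (intMul (vecY j) ω k) _), add_assoc]
  rfl

theorem sum_covInner_number_le {n k : ℕ} (ω : GradedCov n) :
    ∑ j, covInner 0 (extMul (dy j) (intMul (vecY j) ω) k + extMul (dx j) (intMul (vecX j) ω) k)
      (ω k) ≤ k * covInner 0 (ω k) (ω k) := by
  cases k with
  | zero => simp [extMul_zero, covInner_zero_left]
  | succ k =>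
    have := sum_covInner_number (k := k) ω
    have := covInner_self_nonneg 0 (intMul vecT ω k)
    push_cast
    linarith

theorem covInner_lef_self {n k : ℕ} (ω : GradedCov n) :
    covInner 0 (lef n ω (k + 2)) (lef n ω (k + 2)) =
      covInner 0 (lef n (lefDual n ω) k) (ω k) + n * covInner 0 (ω k) (ω k) -
      ∑ j, covInner 0 (extMul (dy j) (intMul (vecY j) ω) k + extMul (dx j) (intMul (vecX j) ω) k)
        (ω k) := by
  rw [covInner_lef, covInner_comm]
  rw [lefDual_lef, covInner_sub_left, covInner_add_left, covInner_smul_left, covInner_sum_left]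

/-- Exterior multiplication by `dθ` is injective below the middle degree. -/
theorem eq_zero_of_wedgeDTheta_eq_zero {n k : ℕ} (hk : k < n) {β : Cov n k}
    (h : wedgeDTheta n k β = 0) : β = 0 := by
  let ω : GradedCov n := Pi.single k β
  have hω : ω k = β := Pi.single_eq_same k β
  have h1 := covInner_lef_self (k := k) ω
  rw [lef_apply_add_two, hω, h, neg_zero, covInner_zero_left] at h1
  have h2 := covInner_lef_lefDual_nonneg (k := k) ω
  have h3 := sum_covInner_number_le (k := k) ω
  rw [hω] at h2 h3
  have h4 := covInner_self_nonneg 0 β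
  have h5 : (k : ℝ) < n := by exact_mod_cast hk
  apply eq_zero_of_covInner_self_eq_zero
  nlinarith

/-- The adjoint Lefschetz operator is injective on horizontal covectors above the middle degree. -/
theorem eq_zero_of_lefDual_eq_zero {n k : ℕ} (hk : n < k + 2) {ω : GradedCov n}
    (hT : contr (k + 1) vecT (ω (k + 2)) = 0) (h : lefDual n ω k = 0) : ω (k + 2) = 0 := by
  have h1 := covInner_lef_self (k := k + 2) ω
  rw [covInner_lef (k := k) (lefDual n ω), h, covInner_zero_left] at h1
  have h2 := sum_covInner_number (k := k + 1) ω
  rw [intMul_apply, hT, covInner_zero_left] at h2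
  have h3 := covInner_self_nonneg 0 (lef n ω (k + 2 + 2))
  have h4 := covInner_self_nonneg 0 (ω (k + 2))
  have h5 : (n : ℝ) < k + 2 := by exact_mod_cast hk
  apply eq_zero_of_covInner_self_eq_zero
  push_cast at h2
  nlinarith

/-! ### The exterior derivative of multiples of the contact form -/

theorem wedge_eq_alternatize {n k : ℕ} (a : Pt n →L[ℝ] ℝ) (ω : Cov n k) :
    ContinuousAlternatingMap.alternatizeUncurryFinCLM ℝ (Pt n) ℝ (a.smulRight ω) = wedge k a ω :=
  rfl

theorem alternatize_wedge_comp {n k : ℕ} (a : Pt n →L[ℝ] ℝ) (B : Pt n →L[ℝ] Cov n k) :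
    ContinuousAlternatingMap.alternatizeUncurryFinCLM ℝ (Pt n) ℝ ((wedge k a).comp B) =
      -wedge (k + 1) a (ContinuousAlternatingMap.alternatizeUncurryFinCLM ℝ (Pt n) ℝ B) := by
  let c (i : Fin n ⊕ Fin n ⊕ Unit) : Pt n →L[ℝ] ℝ :=
    LinearMap.toContinuousLinearMap ((stdBasis n).coord i)
  have hB : B = ∑ i, (c i).smulRight (B (stdBasis n i)) := by
    refine ContinuousLinearMap.ext fun x => ?_
    conv_lhs => rw [← (stdBasis n).sum_repr x]
    simp only [map_sum, map_smul, sum_apply,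
      ContinuousLinearMap.smulRight_apply]
    rfl
  have hA : (wedge k a).comp B = ∑ i, (c i).smulRight (wedge k a (B (stdBasis n i))) := by
    refine ContinuousLinearMap.ext fun x => ?_
    conv_lhs => rw [hB]
    simp only [ContinuousLinearMap.comp_apply, sum_apply, map_sum,
      ContinuousLinearMap.smulRight_apply, map_smul]
  rw [hA, map_sum]
  conv_rhs => rw [hB]
  rw [map_sum, map_sum, ← Finset.sum_neg_distrib]
  refine Finset.sum_congr rfl fun i _ => ?_
  rw [wedge_eq_alternatize, wedge_eq_alternatize, wedge_anticomm]

/-- The derivative of the contact form. -/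
def thetaDeriv (n : ℕ) : Pt n →L[ℝ] Pt n →L[ℝ] ℝ :=
  -((1 / 2 : ℝ) • ∑ j, ((dx j).smulRight (dy j) - (dy j).smulRight (dx j)))

theorem thetaDeriv_apply {n : ℕ} (p : Pt n) :
    thetaDeriv n p = -((1 / 2 : ℝ) • ∑ j, (p.1 j • dy j - p.2.1 j • dx j)) := by
  simp [thetaDeriv, dx, dy]

theorem theta_eq {n : ℕ} (p : Pt n) : theta p = dt + thetaDeriv n p := by
  rw [thetaDeriv_apply, theta, sub_eq_add_neg]

theorem hasFDerivAt_theta {n : ℕ} (p : Pt n) : HasFDerivAt theta (thetaDeriv n) p := by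
  have : (theta : Pt n → _) = fun p => dt + thetaDeriv n p := funext theta_eq
  rw [this]
  exact (thetaDeriv n).hasFDerivAt.const_add dt

theorem theta_vecT {n : ℕ} (p : Pt n) : theta p vecT = 1 := by
  simp [theta, dx_vecT, dy_vecT]
  simp [dt, vecT]

theorem alternatize_thetaDeriv {n k : ℕ} (ω : Cov n k) :
    ContinuousAlternatingMap.alternatizeUncurryFinCLM ℝ (Pt n) ℝ
      (((wedgeL n k).flip ω).comp (thetaDeriv n)) = wedgeDTheta n k ω := by
  have h : ((wedgeL n k).flip ω).comp (thetaDeriv n) =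
      -((1 / 2 : ℝ) • ∑ j, ((dx j).smulRight (wedge k (dy j) ω) -
        (dy j).smulRight (wedge k (dx j) ω))) := by
    refine ContinuousLinearMap.ext fun x => ?_
    simp only [thetaDeriv, ContinuousLinearMap.comp_apply, ContinuousLinearMap.flip_apply,
      neg_apply, smul_apply,
      sum_apply, sub_apply, map_neg, map_smul, map_sum,
      map_sub, ContinuousLinearMap.smulRight_apply, wedgeL_apply]
  rw [h]
  simp only [map_neg, map_smul, map_sum, map_sub, wedge_eq_alternatize]
  simp only [wedge_anticomm (dy _), sub_neg_eq_add, ← two_smul ℝ, ← Finset.smul_sum, smul_smul]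
  simp [wedgeDTheta]

theorem hasFDerivAt_bilinear {E A F G : Type*} [NormedAddCommGroup E] [NormedSpace ℝ E]
    [NormedAddCommGroup A] [NormedSpace ℝ A] [NormedAddCommGroup F] [NormedSpace ℝ F]
    [NormedAddCommGroup G] [NormedSpace ℝ G] (B : A →L[ℝ] F →L[ℝ] G) {a : E → A} {f : E → F}
    {a' : E →L[ℝ] A} {f' : E →L[ℝ] F} {p : E} (ha : HasFDerivAt a a' p)
    (hf : HasFDerivAt f f' p) :
    HasFDerivAt (fun q => B (a q) (f q)) ((B (a p)).comp f' + (B.flip (f p)).comp a') p :=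
  B.hasFDerivAt_of_bilinear ha hf

theorem extDeriv_theta_wedge {n k : ℕ} {β : Pt n → Cov n k} {p : Pt n}
    (hβ : DifferentiableAt ℝ β p) :
    extDeriv (fun q => wedge k (theta q) (β q)) p =
      wedgeDTheta n k (β p) - wedge (k + 1) (theta p) (extDeriv β p) := by
  have h : HasFDerivAt (fun q => wedge k (theta q) (β q))
      ((wedge k (theta p)).comp (fderiv ℝ β p) +
        ((wedgeL n k).flip (β p)).comp (thetaDeriv n)) p :=
    hasFDerivAt_bilinear (A := Pt n →L[ℝ] ℝ) (F := Cov n k) (G := Cov n (k + 1)) (wedgeL n k)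
      (hasFDerivAt_theta p) hβ.hasFDerivAt
  rw [extDeriv, h.fderiv]
  change ContinuousAlternatingMap.alternatizeUncurryFinCLM ℝ (Pt n) ℝ _ = _
  rw [map_add, alternatize_thetaDeriv, alternatize_wedge_comp, neg_add_eq_sub]
  rfl

theorem extDeriv_wedge_const {n k : ℕ} (a : Pt n →L[ℝ] ℝ) {β : Pt n → Cov n k} {p : Pt n}
    (hβ : DifferentiableAt ℝ β p) :
    extDeriv (fun q => wedge k a (β q)) p = -wedge (k + 1) a (extDeriv β p) := by
  have h : HasFDerivAt (fun q => wedge k a (β q)) ((wedge k a).comp (fderiv ℝ β p)) p :=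
    (wedge k a).hasFDerivAt.comp p hβ.hasFDerivAt
  rw [extDeriv, h.fderiv]
  exact alternatize_wedge_comp _ _

/-! ### Decomposition into vertical and horizontal parts -/

theorem wedgeDTheta_wedge {n k : ℕ} (a : Pt n →L[ℝ] ℝ) (ω : Cov n k) :
    wedgeDTheta n (k + 1) (wedge k a ω) = wedge (k + 2) a (wedgeDTheta n k ω) := by
  simp only [wedgeDTheta, neg_apply, sum_apply,
    ContinuousLinearMap.comp_apply, map_neg, map_sum]
  congr 1
  refine Finset.sum_congr rfl fun j _ => ?_
  rw [wedge_anticomm (dy j) a, map_neg, wedge_anticomm (dx j) a, neg_neg]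

theorem contr_vecT_theta_wedge {n k : ℕ} (p : Pt n) (ω : Cov n (k + 1)) :
    contr (k + 1) vecT (wedge (k + 1) (theta p) ω) =
      ω - wedge k (theta p) (contr k vecT ω) := by
  rw [contr_wedge, theta_vecT, one_smul]

theorem contr_vecT_theta_wedge_zero {n : ℕ} (p : Pt n) (ω : Cov n 0) :
    contr 0 vecT (wedge 0 (theta p) ω) = ω := by
  rw [contr_wedge_zero, theta_vecT, one_smul]

/-- A multiple of the contact form is recovered from its contraction with `∂_t`. -/
theorem theta_wedge_contr_of_theta_wedge_eq_zero {n k : ℕ} {p : Pt n} {ω : Cov n (k + 1)}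
    (h : wedge (k + 1) (theta p) ω = 0) : wedge k (theta p) (contr k vecT ω) = ω := by
  have := contr_vecT_theta_wedge p ω
  rw [h, map_zero] at this
  exact (sub_eq_zero.mp this.symm).symm

theorem contr_contr {n k : ℕ} (v : Pt n) (ω : Cov n (k + 2)) :
    contr k v (contr (k + 1) v ω) = 0 :=
  ContinuousAlternatingMap.curryLeft_same ω v

/-- Covectors in the kernel of the contraction with `∂_t`. -/
def horiz (n : ℕ) : (k : ℕ) → Submodule ℝ (Cov n k)
  | 0 => ⊤
  | k + 1 => LinearMap.ker (contr k vecT).toLinearMap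

theorem mem_horiz_succ {n k : ℕ} {ω : Cov n (k + 1)} :
    ω ∈ horiz n (k + 1) ↔ contr k vecT ω = 0 := Iff.rfl

theorem contr_mem_horiz {n k : ℕ} (ω : Cov n (k + 1)) : contr k vecT ω ∈ horiz n k := by
  cases k with
  | zero => trivial
  | succ k => exact contr_contr vecT ω

theorem wedge_mem_horiz {n k : ℕ} {a : Pt n →L[ℝ] ℝ} (ha : a vecT = 0) {ω : Cov n k}
    (hω : ω ∈ horiz n k) : wedge k a ω ∈ horiz n (k + 1) := by
  cases k with
  | zero => rw [mem_horiz_succ, contr_wedge_zero, ha, zero_smul]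
  | succ k => rw [mem_horiz_succ, contr_wedge, ha, mem_horiz_succ.mp hω, zero_smul, map_zero,
      sub_zero]

theorem wedgeDTheta_mem_horiz {n k : ℕ} {ω : Cov n k} (hω : ω ∈ horiz n k) :
    wedgeDTheta n k ω ∈ horiz n (k + 2) := by
  rw [wedgeDTheta, neg_apply, sum_apply]
  exact neg_mem (sum_mem fun j _ =>
    wedge_mem_horiz (dx_vecT j) (wedge_mem_horiz (dy_vecT j) hω))

theorem eq_zero_of_theta_wedge_eq_zero {n k : ℕ} {p : Pt n} {ω : Cov n k} (hω : ω ∈ horiz n k)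
    (h : wedge k (theta p) ω = 0) : ω = 0 := by
  cases k with
  | zero => rw [← contr_vecT_theta_wedge_zero p ω, h, map_zero]
  | succ k =>
    rw [← theta_wedge_contr_of_theta_wedge_eq_zero h, mem_horiz_succ.mp hω, map_zero]

/-! ### Uniqueness of the vertical correction -/

/-- In the middle degree, a vertical form `γ` is determined by the horizontal part of `dγ`. -/
theorem eq_zero_of_vertical {n : ℕ} {γ : Pt n → Cov n n} {p : Pt n}
    (hγ : DifferentiableAt ℝ γ p) (h0 : ∀ q, wedge n (theta q) (γ q) = 0)
    (h1 : wedge (n + 1) (theta p) (extDeriv γ p) = 0) : γ p = 0 := by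
  cases n with
  | zero => exact eq_zero_of_theta_wedge_eq_zero trivial (h0 p)
  | succ m =>
    have hβ : DifferentiableAt ℝ (fun q => contr m vecT (γ q)) p :=
      (contr m vecT).differentiableAt.comp p hγ
    have hγβ : γ = fun q => wedge m (theta q) (contr m vecT (γ q)) :=
      funext fun q => (theta_wedge_contr_of_theta_wedge_eq_zero (h0 q)).symm
    have h2 : wedgeDTheta (m + 1) m (contr m vecT (γ p)) = 0 := by
      rw [hγβ, extDeriv_theta_wedge hβ, map_sub, wedge_self, sub_zero] at h1
      exact eq_zero_of_theta_wedge_eq_zero (wedgeDTheta_mem_horiz (contr_mem_horiz (γ p))) h1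
    rw [hγβ]
    simp only
    rw [eq_zero_of_wedgeDTheta_eq_zero (Nat.lt_succ_self m) h2, map_zero]

/-! ### Inverting the Lefschetz operator -/

/-- The components of a covector with respect to the frame at the origin. -/
def components (n k : ℕ) : Cov n k →ₗ[ℝ] (Fin k → Fin n ⊕ Fin n ⊕ Unit) → ℝ where
  toFun ω i := ω fun l => frame 0 (i l)
  map_add' _ _ := rfl
  map_smul' _ _ := rfl

theorem components_injective (n k : ℕ) : Function.Injective (components n k) := by
  rw [injective_iff_map_eq_zero]
  intro ω h
  apply eq_zero_of_covInner_self_eq_zero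
  have h0 (i : Fin k → Fin n ⊕ Fin n ⊕ Unit) : ω (fun l => frame 0 (i l)) = 0 := congrFun h i
  simp [covInner, h0]

instance instFiniteDimensionalCov (n k : ℕ) : FiniteDimensional ℝ (Cov n k) :=
  FiniteDimensional.of_injective (components n k) (components_injective n k)

/-- A left inverse of the exterior multiplication by `dθ` below the middle degree. -/
theorem exists_leftInverse_wedgeDTheta {n k : ℕ} (hk : k < n) :
    ∃ S : Cov n (k + 2) →L[ℝ] Cov n k, ∀ β, S (wedgeDTheta n k β) = β := by
  obtain ⟨g, hg⟩ := LinearMap.exists_leftInverse_of_injective (wedgeDTheta n k).toLinearMap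
    (LinearMap.ker_eq_bot'.mpr fun β h => eq_zero_of_wedgeDTheta_eq_zero hk h)
  exact ⟨LinearMap.toContinuousLinearMap g, fun β => LinearMap.congr_fun hg β⟩

theorem contr_anticomm {n k : ℕ} (v w : Pt n) (ω : Cov n (k + 2)) :
    contr k v (contr (k + 1) w ω) = -contr k w (contr (k + 1) v ω) := by
  have hadd (k : ℕ) (η : Cov n (k + 1)) : contr k (v + w) η = contr k v η + contr k w η := by
    simp [contr]
  have h := contr_contr (v + w) ω
  rw [hadd, hadd, map_add, map_add, contr_contr, contr_contr, zero_add, add_zero] at h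
  rw [eq_neg_iff_add_eq_zero, h]

theorem contr_mem_horiz_of_mem {n k : ℕ} (v : Pt n) {ω : Cov n (k + 1)}
    (hω : ω ∈ horiz n (k + 1)) : contr k v ω ∈ horiz n k := by
  cases k with
  | zero => trivial
  | succ k => rw [mem_horiz_succ, contr_anticomm, mem_horiz_succ.mp hω, map_zero, neg_zero]

theorem exists_map_eq_of_injOn {V W : Type*} [AddCommGroup V] [Module ℝ V] [AddCommGroup W]
    [Module ℝ W] [FiniteDimensional ℝ V] [FiniteDimensional ℝ W] {p : Submodule ℝ V}
    {q : Submodule ℝ W} {f : V →ₗ[ℝ] W} {g : W →ₗ[ℝ] V} (hf : ∀ x ∈ p, f x ∈ q)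
    (hg : ∀ y ∈ q, g y ∈ p) (hf0 : ∀ x ∈ p, f x = 0 → x = 0) (hg0 : ∀ y ∈ q, g y = 0 → y = 0)
    {y : W} (hy : y ∈ q) : ∃ x, f x = y := by
  have hf' : Function.Injective (f.restrict hf) := by
    rw [injective_iff_map_eq_zero]
    exact fun x h => Subtype.ext (hf0 x x.2 (congrArg Subtype.val h))
  have hg' : Function.Injective (g.restrict hg) := by
    rw [injective_iff_map_eq_zero]
    exact fun x h => Subtype.ext (hg0 x x.2 (congrArg Subtype.val h))
  have hdim : Module.finrank ℝ p = Module.finrank ℝ q :=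
    le_antisymm (LinearMap.finrank_le_finrank_of_injective hf')
      (LinearMap.finrank_le_finrank_of_injective hg')
  obtain ⟨x, hx⟩ :=
    (LinearMap.injective_iff_surjective_of_finrank_eq_finrank hdim).mp hf' ⟨y, hy⟩
  exact ⟨x, congrArg Subtype.val hx⟩

/-- In the middle degrees, exterior multiplication by `dθ` is onto the horizontal covectors. -/
theorem exists_wedgeDTheta_eq {m : ℕ} {η : Cov (m + 1) (m + 2)} (hη : η ∈ horiz (m + 1) (m + 2)) :
    ∃ β, wedgeDTheta (m + 1) m β = η := by
  refine exists_map_eq_of_injOn (f := (wedgeDTheta (m + 1) m).toLinearMap)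
    (g := ∑ j, ((contr m (vecY j)).comp (contr (m + 1) (vecX j))).toLinearMap)
    (p := horiz (m + 1) m) (q := horiz (m + 1) (m + 2)) (fun _ h => wedgeDTheta_mem_horiz h)
    (fun ω hω => ?_) (fun _ _ h => eq_zero_of_wedgeDTheta_eq_zero (Nat.lt_succ_self m) h)
    (fun η hη h => ?_) hη
  · rw [LinearMap.sum_apply]
    exact sum_mem fun j _ => contr_mem_horiz_of_mem _ (contr_mem_horiz_of_mem _ hω)
  · let ω : GradedCov (m + 1) := Pi.single (m + 2) η
    have hω : ω (m + 2) = η := Pi.single_eq_same _ η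
    have h0 : lefDual (m + 1) ω m = 0 := by
      rw [LinearMap.sum_apply] at h
      simp only [lefDual, LinearMap.sum_apply, Finset.sum_apply, Module.End.mul_apply,
        intMul_apply, hω]
      exact h
    exact hω.symm.trans (eq_zero_of_lefDual_eq_zero (Nat.lt_succ_self _) (by rw [hω]; exact hη) h0)

theorem eq_zero_of_mem_horiz_dim_zero {k : ℕ} {η : Cov 0 (k + 1)} (hη : η ∈ horiz 0 (k + 1)) :
    η = 0 := by
  let ω : GradedCov 0 := Pi.single (k + 1) η
  have hω : ω (k + 1) = η := Pi.single_eq_same _ η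
  have h := sum_covInner_number (k := k) ω
  rw [intMul_apply, hω, mem_horiz_succ.mp hη, covInner_zero_left, Finset.univ_eq_empty,
    Finset.sum_empty, add_zero] at h
  have hk : ((k : ℝ) + 1) ≠ 0 := by positivity
  exact eq_zero_of_covInner_self_eq_zero ((mul_eq_zero.mp h.symm).resolve_left hk)

/-! ### Multiplication of test functions by smooth operators -/

section SmoothMul

variable {E F G : Type*} [NormedAddCommGroup E] [NormedSpace ℝ E] [NormedAddCommGroup F]
  [NormedSpace ℝ F] [NormedAddCommGroup G] [NormedSpace ℝ G]

/-- Application of a smooth field of operators to functions supported in a compact set. -/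
def supportedMulCLM (K : Compacts E) {g : E → F →L[ℝ] G} (hg : ContDiff ℝ (⊤ : ℕ∞) g) :
    𝓓_{K}(E, F) →L[ℝ] 𝓓_{K}(E, G) :=
  ContDiffMapSupportedIn.mkCLM ℝ (fun f x => g x (f x)) (fun f h x => by simp)
    (fun c f x => by simp) (fun f => hg.clm_apply f.contDiff)
    (fun f x hx => by simp [f.zero_on_compl hx])
    (fun i _ => by
      have hC (j : ℕ) : ∃ C, ∀ x ∈ K, ‖iteratedFDeriv ℝ j g x‖ ≤ C :=
        K.isCompact.exists_bound_of_continuousOn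
          (hg.continuous_iteratedFDeriv (m := j) (by exact_mod_cast le_top)).continuousOn
      choose C hC using hC
      refine ⟨Finset.range (i + 1), ∑ j ∈ Finset.range (i + 1), (i.choose j : ℝ) * |C j|,
        Finset.sum_nonneg fun j _ => by positivity, fun f x hx => ?_⟩
      refine (norm_iteratedFDeriv_clm_apply hg f.contDiff x (by exact_mod_cast le_top)).trans ?_
      rw [Finset.sum_mul]
      refine Finset.sum_le_sum fun j hj => ?_
      refine mul_le_mul (mul_le_mul_of_nonneg_left ((hC j x hx).trans (le_abs_self _))
        (by positivity)) ?_ (norm_nonneg _) (by positivity)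
      refine (ContDiffMapSupportedIn.norm_iteratedFDeriv_apply_le_seminorm_top ℝ).trans ?_
      exact Seminorm.le_finset_sup_apply (p := fun j => ContDiffMapSupportedIn.seminorm ℝ E F ⊤ K j)
        (Finset.mem_range.mpr (by omega)))

/-- Application of a smooth field of operators to test functions. -/
def smoothMulCLM (Ω : Opens E) {g : E → F →L[ℝ] G} (hg : ContDiff ℝ (⊤ : ℕ∞) g) :
    𝓓(Ω, F) →L[ℝ] 𝓓(Ω, G) :=
  letI Φ (f : 𝓓(Ω, F)) : 𝓓(Ω, G) :=
    ⟨fun x => g x (f x), hg.clm_apply f.contDiff,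
      f.hasCompactSupport.mono fun x hx h => hx (by simp [h]),
      (closure_mono (Function.support_subset_iff'.mpr fun x hx => by
        simp [Function.notMem_support.mp hx])).trans f.tsupport_subset⟩
  TestFunction.limitCLM ℝ Φ
    (fun K K_sub => TestFunction.ofSupportedInCLM ℝ K_sub ∘L supportedMulCLM K hg)
    (fun _ _ _ => rfl)

end SmoothMul

section

/-! ### Operators on test forms -/

theorem contDiff_wedge_theta (n k : ℕ) :
    ContDiff ℝ (⊤ : ℕ∞) (fun p : Pt n => wedge k (theta p)) := by
  have h : (fun p : Pt n => wedge k (theta p)) =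
      fun p => wedge k dt + (wedgeL n k).comp (thetaDeriv n) p := by
    ext1 p
    rw [theta_eq, ← wedgeL_apply, map_add]
    rfl
  rw [h]
  exact contDiff_const.add (ContinuousLinearMap.contDiff (F := Cov n k →L[ℝ] Cov n (k + 1)) _)

variable {n : ℕ} (U : Opens (Pt n))

/-- The operator `ω ↦ θ ∧ ω` on test forms. -/
def thetaMul (k : ℕ) : TestForm U k →L[ℝ] TestForm U (k + 1) :=
  smoothMulCLM U (contDiff_wedge_theta n k)

/-- The operator `ω ↦ dθ ∧ ω` on test forms. -/
def dThetaMul (k : ℕ) : TestForm U k →L[ℝ] TestForm U (k + 2) :=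
  TestFunction.postcompCLM (wedgeDTheta n k)

/-- The contraction of test forms with `∂_t`. -/
def contrT (k : ℕ) : TestForm U (k + 1) →L[ℝ] TestForm U k :=
  TestFunction.postcompCLM (contr k vecT)

variable {U} {k : ℕ}

theorem thetaMul_apply (ω : TestForm U k) (p : Pt n) :
    thetaMul U k ω p = wedge k (theta p) (ω p) := rfl

theorem dThetaMul_apply (ω : TestForm U k) (p : Pt n) :
    dThetaMul U k ω p = wedgeDTheta n k (ω p) := rfl

theorem contrT_apply (ω : TestForm U (k + 1)) (p : Pt n) :
    contrT U k ω p = contr k vecT (ω p) := rfl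

theorem testForm_differentiableAt (ω : TestForm U k) (p : Pt n) : DifferentiableAt ℝ ω p :=
  (ω.contDiff.differentiable (by simp)).differentiableAt

theorem extD_thetaMul (ω : TestForm U k) :
    extD U (k + 1) (thetaMul U k ω) =
      dThetaMul U k ω - thetaMul U (k + 1) (extD U k ω) := by
  ext1 p
  rw [extD_apply, sub_apply, thetaMul_apply, dThetaMul_apply, extD_apply]
  exact extDeriv_theta_wedge (testForm_differentiableAt ω p)

theorem extD_postcomp_wedge (a : Pt n →L[ℝ] ℝ) (ω : TestForm U k) :
    extD U (k + 1) (TestFunction.postcompCLM (wedge k a) ω) =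
      -TestFunction.postcompCLM (wedge (k + 1) a) (extD U k ω) := by
  ext1 p
  have h := extDeriv_wedge_const a (testForm_differentiableAt ω p)
  rw [← extD_apply] at h
  rw [extD_apply, neg_apply]
  exact h

theorem dThetaMul_eq (ω : TestForm U k) :
    dThetaMul U k ω = -∑ j, TestFunction.postcompCLM (wedge (k + 1) (dx j))
      (TestFunction.postcompCLM (wedge k (dy j)) ω) := by
  ext1 p
  rw [dThetaMul_apply, wedgeDTheta]
  simp [sum_apply, neg_apply]

theorem extD_dThetaMul (ω : TestForm U k) :
    extD U (k + 2) (dThetaMul U k ω) = dThetaMul U (k + 1) (extD U k ω) := by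
  rw [dThetaMul_eq, dThetaMul_eq, map_neg, map_sum]
  simp only [extD_postcomp_wedge, map_neg, neg_neg]

theorem extD_extD (ω : TestForm U k) : extD U (k + 1) (extD U k ω) = 0 := by
  ext1 p
  have h : (extD U k ω : Pt n → Cov n (k + 1)) = extDeriv ω := funext (extD_apply ω)
  rw [extD_apply, h]
  exact extDeriv_extDeriv_apply (r := (⊤ : ℕ∞)) ω.contDiff.contDiffAt
    (by
      rw [minSmoothness_of_isRCLikeNormedField]
      exact WithTop.coe_le_coe.mpr (le_top (a := (2 : ℕ∞))))

theorem thetaMul_thetaMul (ω : TestForm U k) : thetaMul U (k + 1) (thetaMul U k ω) = 0 := by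
  ext1 p
  exact wedge_self _ _

/-- The horizontal part `ω - θ ∧ ι_T ω = ι_T (θ ∧ ω)` of a test form. -/
def horizPart (ω : TestForm U k) : TestForm U k := contrT U k (thetaMul U k ω)

theorem horizPart_add_vertical (ω : TestForm U (k + 1)) :
    thetaMul U k (contrT U k ω) + horizPart ω = ω := by
  ext1 p
  rw [add_apply, horizPart, contrT_apply, thetaMul_apply, thetaMul_apply, contrT_apply,
    contr_vecT_theta_wedge, add_sub_cancel]

theorem thetaMul_horizPart (ω : TestForm U (k + 1)) :
    thetaMul U (k + 1) (horizPart ω) = thetaMul U (k + 1) ω := by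
  conv_rhs => rw [← horizPart_add_vertical ω, map_add, thetaMul_thetaMul, zero_add]

theorem horizPart_mem_horiz (ω : TestForm U k) (p : Pt n) : horizPart ω p ∈ horiz n k :=
  contr_mem_horiz _

/-! ### Sections of the ideal generated by the contact form -/

theorem horizPart_eq_zero_of_mem_formsI_one {ω : TestForm U 1} (hω : ω ∈ formsI U 1) :
    horizPart ω = 0 := by
  ext1 p
  obtain ⟨α, hα⟩ : ∃ α, wedge 0 (theta p) α = ω p := hω p
  rw [horizPart, contrT_apply, thetaMul_apply, ← hα, wedge_self, map_zero]
  rfl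

theorem exists_horizPart_eq_of_mem_formsI {ω : TestForm U (k + 2)} (hk : k < n)
    (hω : ω ∈ formsI U (k + 2)) : ∃ β : TestForm U k, horizPart ω = dThetaMul U k β := by
  obtain ⟨S, hS⟩ := exists_leftInverse_wedgeDTheta hk
  refine ⟨TestFunction.postcompCLM S (horizPart ω), ?_⟩
  ext1 p
  obtain ⟨_, ⟨α, rfl⟩, _, ⟨β, rfl⟩, hαβ⟩ := Submodule.mem_sup.mp (hω p)
  have h : horizPart ω p = wedgeDTheta n k (contr k vecT (wedge k (theta p) β)) := by
    rw [horizPart, contrT_apply, thetaMul_apply, ← hαβ, map_add, map_add]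
    simp only [ContinuousLinearMap.coe_coe, wedge_self, map_zero, zero_add]
    rw [← wedgeDTheta_wedge]
    simp only [wedgeDTheta, neg_apply, sum_apply, ContinuousLinearMap.comp_apply, map_neg,
      map_sum, contr_wedge, dx_vecT, dy_vecT, zero_smul, zero_sub, neg_neg]
  rw [dThetaMul_apply, TestFunction.postcompCLM_apply, Function.comp_apply, h, hS]

theorem thetaMul_mem_formsI (ω : TestForm U k) : thetaMul U k ω ∈ formsI U (k + 1) := by
  intro p
  cases k with
  | zero => exact ⟨ω p, rfl⟩
  | succ k => exact Submodule.mem_sup_left ⟨ω p, rfl⟩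

theorem dThetaMul_mem_formsI (ω : TestForm U k) : dThetaMul U k ω ∈ formsI U (k + 2) :=
  fun p => Submodule.mem_sup_right ⟨ω p, rfl⟩

theorem eq_zero_of_mem_formsI_zero {ω : TestForm U 0} (hω : ω ∈ formsI U 0) : ω = 0 := by
  ext1 p
  exact hω p

theorem extD_mem_formsI (hk : k < n) {ω : TestForm U k} (hω : ω ∈ formsI U k) :
    extD U k ω ∈ formsI U (k + 1) := by
  match k with
  | 0 =>
    rw [eq_zero_of_mem_formsI_zero hω, map_zero]
    exact zero_mem _
  | 1 =>
    rw [← horizPart_add_vertical ω, horizPart_eq_zero_of_mem_formsI_one hω, add_zero,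
      extD_thetaMul]
    exact sub_mem (dThetaMul_mem_formsI _) (thetaMul_mem_formsI _)
  | k + 2 =>
    obtain ⟨β, hβ⟩ := exists_horizPart_eq_of_mem_formsI (by omega) hω
    rw [← horizPart_add_vertical ω, hβ, map_add, extD_thetaMul, extD_dThetaMul]
    exact add_mem (sub_mem (dThetaMul_mem_formsI _) (thetaMul_mem_formsI _))
      (dThetaMul_mem_formsI _)

/-! ### Existence of the Rumin differential -/

theorem mem_formsJ_iff {ω : TestForm U k} :
    ω ∈ formsJ U k ↔ thetaMul U k ω = 0 ∧ dThetaMul U k ω = 0 := by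
  constructor
  · intro h
    exact ⟨DFunLike.ext _ _ fun p => (h p).1, DFunLike.ext _ _ fun p => (h p).2⟩
  · rintro ⟨h1, h2⟩ p
    exact ⟨DFunLike.congr_fun h1 p, DFunLike.congr_fun h2 p⟩

theorem extD_mem_formsJ {ω : TestForm U k} (h : thetaMul U (k + 1) (extD U k ω) = 0) :
    extD U k ω ∈ formsJ U (k + 1) := by
  refine mem_formsJ_iff.mpr ⟨h, ?_⟩
  have := extD_thetaMul (extD U k ω)
  rwa [h, extD_extD, map_zero, map_zero, sub_zero, eq_comm] at this

theorem thetaMul_extD_of_mem_formsJ {ω : TestForm U k} (hω : ω ∈ formsJ U k) :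
    thetaMul U (k + 1) (extD U k ω) = 0 := by
  obtain ⟨h1, h2⟩ := mem_formsJ_iff.mp hω
  have := extD_thetaMul ω
  rwa [h1, h2, map_zero, zero_sub, eq_comm, neg_eq_zero] at this

theorem reps_of_le (hk : k ≤ n) : reps U k = ⊤ := if_pos hk

theorem reps_of_lt (hk : n < k) : reps U k = formsJ U k := if_neg (not_le.mpr hk)

theorem nulls_of_le (hk : k ≤ n) : nulls U k = formsI U k := if_pos hk

theorem nulls_of_lt (hk : n < k) : nulls U k = ⊥ := if_neg (not_le.mpr hk)

/-- An operator on test forms that preserves representatives and null forms induces an operator on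
Rumin forms. -/
theorem exists_lift {l : ℕ} (A : TestForm U k →L[ℝ] TestForm U l)
    (hA : ∀ ω ∈ reps U k, A ω ∈ reps U l) (hN : ∀ ω ∈ nulls U k, A ω ∈ nulls U l) :
    ∃ D : RForm U k →L[ℝ] RForm U l, ∀ ω : reps U k, D (cls ω) = cls ⟨A ω, hA ω ω.2⟩ := by
  let B : reps U k →L[ℝ] reps U l :=
    (A.comp (reps U k).subtypeL).codRestrict (reps U l) fun ω => hA ω ω.2
  let C : reps U k →L[ℝ] RForm U l :=
    (Submodule.mkQL ((nulls U l).submoduleOf (reps U l))).comp B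
  refine ⟨⟨Submodule.liftQ _ C.toLinearMap fun ω hω => ?_, C.continuous.quotient_lift _⟩,
    fun ω => rfl⟩
  exact (Submodule.Quotient.mk_eq_zero _).mpr (hN ω hω)

/-- The vertical correction of a form in the middle degree is unique. -/
theorem vertical_unique {γ γ' : TestForm U n} (h : thetaMul U n γ = thetaMul U n γ')
    (hd : thetaMul U (n + 1) (extD U n γ) = thetaMul U (n + 1) (extD U n γ')) : γ = γ' := by
  rw [← sub_eq_zero]
  have h0 : thetaMul U n (γ - γ') = 0 := by rw [map_sub, h, sub_self]
  have h1 : thetaMul U (n + 1) (extD U n (γ - γ')) = 0 := by rw [map_sub, map_sub, hd, sub_self]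
  ext1 p
  refine eq_zero_of_vertical (testForm_differentiableAt _ p)
    (fun q => DFunLike.congr_fun h0 q) ?_
  rw [← extD_apply]
  exact DFunLike.congr_fun h1 p

/-- The vertical correction in the middle degree, as an operator on test forms. -/
theorem exists_vertical_correction (U : Opens (Pt n)) :
    ∃ Γ : TestForm U n →L[ℝ] TestForm U n, ∀ ω, thetaMul U n (Γ ω) = 0 ∧
      thetaMul U (n + 1) (extD U n (ω + Γ ω)) = 0 := by
  cases n with
  | zero =>
    refine ⟨0, fun ω => ⟨by simp, ?_⟩⟩
    rw [← thetaMul_horizPart]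
    have : horizPart (extD U 0 (ω + (0 : TestForm U 0 →L[ℝ] TestForm U 0) ω)) = 0 :=
      DFunLike.ext _ _ fun p => eq_zero_of_mem_horiz_dim_zero (horizPart_mem_horiz _ p)
    rw [this, map_zero]
  | succ m =>
    obtain ⟨S, hS⟩ := exists_leftInverse_wedgeDTheta (Nat.lt_succ_self m)
    let B : TestForm U (m + 1) →L[ℝ] TestForm U m :=
      (TestFunction.postcompCLM S).comp
        ((contrT U (m + 2)).comp ((thetaMul U (m + 2)).comp (extD U (m + 1))))
    have hB (ω : TestForm U (m + 1)) : dThetaMul U m (B ω) = horizPart (extD U (m + 1) ω) := by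
      ext1 p
      obtain ⟨β, hβ⟩ := exists_wedgeDTheta_eq (horizPart_mem_horiz (extD U (m + 1) ω) p)
      have : B ω p = S (horizPart (extD U (m + 1) ω) p) := rfl
      rw [dThetaMul_apply, this, ← hβ, hS]
    refine ⟨-(thetaMul U m).comp B, fun ω => ?_⟩
    have hΓ : (-(thetaMul U m).comp B) ω = -thetaMul U m (B ω) := rfl
    rw [hΓ]
    refine ⟨by rw [map_neg, thetaMul_thetaMul, neg_zero], ?_⟩
    rw [map_add, map_neg, extD_thetaMul, hB, map_add, map_neg, map_sub, thetaMul_thetaMul,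
      sub_zero, thetaMul_horizPart, add_neg_cancel]

theorem extD_vertical_correction_eq_zero {ω γ : TestForm U n} (hω : ω ∈ formsI U n)
    (h0 : thetaMul U n γ = 0) (h1 : thetaMul U (n + 1) (extD U n (ω + γ)) = 0) :
    extD U n (ω + γ) = 0 := by
  suffices h : ∃ γ' : TestForm U n, thetaMul U n γ' = 0 ∧ extD U n (ω + γ') = 0 by
    obtain ⟨γ', h0', h1'⟩ := h
    have : γ = γ' := by
      refine vertical_unique (h0.trans h0'.symm) ?_
      have h2 : thetaMul U (n + 1) (extD U n (ω + γ)) = thetaMul U (n + 1) (extD U n (ω + γ')) := by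
        rw [h1, h1', map_zero]
      simpa [map_add] using h2
    rw [this, h1']
  match n with
  | 0 => exact ⟨0, by simp, by simp [eq_zero_of_mem_formsI_zero hω]⟩
  | 1 =>
    refine ⟨-thetaMul U 0 (contrT U 0 ω), by rw [map_neg, thetaMul_thetaMul, neg_zero], ?_⟩
    conv_lhs => enter [2, 1]; rw [← horizPart_add_vertical ω]
    rw [horizPart_eq_zero_of_mem_formsI_one hω, add_zero, add_neg_cancel, map_zero]
  | m + 2 =>
    obtain ⟨β, hβ⟩ := exists_horizPart_eq_of_mem_formsI (by omega) hω
    refine ⟨-thetaMul U (m + 1) (contrT U (m + 1) ω) - thetaMul U (m + 1) (extD U m β), ?_, ?_⟩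
    · rw [map_sub, map_neg, thetaMul_thetaMul, thetaMul_thetaMul, neg_zero, sub_zero]
    · have h : ω + (-thetaMul U (m + 1) (contrT U (m + 1) ω) - thetaMul U (m + 1) (extD U m β)) =
          extD U (m + 1) (thetaMul U m β) := by
        rw [extD_thetaMul, ← hβ]
        nth_rewrite 1 [← horizPart_add_vertical ω]
        abel
      rw [h, extD_extD]

theorem exists_isRuminDifferential (U : Opens (Pt n)) (k : ℕ) :
    ∃ D, IsRuminDifferential U k D := by
  rcases lt_trichotomy k n with hk | hk | hk
  · have hr : ∀ ω ∈ reps U k, extD U k ω ∈ reps U (k + 1) := fun ω _ => by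
      rw [reps_of_le (Nat.succ_le_of_lt hk)]
      trivial
    obtain ⟨D, hD⟩ := exists_lift (extD U k) hr fun ω hω => by
      rw [nulls_of_le (Nat.succ_le_of_lt hk)]
      rw [nulls_of_le hk.le] at hω
      exact extD_mem_formsI hk hω
    exact ⟨D, fun _ ω => ⟨_, rfl, hD ω⟩, fun h => absurd h hk.ne, fun h => absurd h hk.not_gt⟩
  · subst hk
    obtain ⟨Γ, hΓ⟩ := exists_vertical_correction U
    have hr : ∀ ω ∈ reps U k, (extD U k).comp (.id ℝ _ + Γ) ω ∈ reps U (k + 1) := fun ω _ => by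
      rw [reps_of_lt (Nat.lt_succ_self k)]
      exact extD_mem_formsJ (hΓ ω).2
    obtain ⟨D, hD⟩ := exists_lift _ hr fun ω hω => by
      rw [nulls_of_lt (Nat.lt_succ_self k)]
      rw [nulls_of_le le_rfl] at hω
      exact extD_vertical_correction_eq_zero hω (hΓ ω).1 (hΓ ω).2
    exact ⟨D, fun h => absurd h (lt_irrefl _), fun _ ω => ⟨Γ ω, _,
      fun p => DFunLike.congr_fun (hΓ ω).1 p, fun p => DFunLike.congr_fun (hΓ ω).2 p, rfl, hD ω⟩,
      fun h => absurd h (lt_irrefl _)⟩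
  · have hr : ∀ ω ∈ reps U k, extD U k ω ∈ reps U (k + 1) := fun ω hω => by
      rw [reps_of_lt (hk.trans (Nat.lt_succ_self k))]
      rw [reps_of_lt hk] at hω
      exact extD_mem_formsJ (thetaMul_extD_of_mem_formsJ hω)
    obtain ⟨D, hD⟩ := exists_lift (extD U k) hr fun ω hω => by
      rw [nulls_of_lt hk] at hω
      rw [(Submodule.mem_bot ℝ).mp hω, map_zero]
      exact zero_mem _
    exact ⟨D, fun h => absurd h hk.not_gt, fun h => absurd h hk.ne', fun _ ω => ⟨_, rfl, hD ω⟩⟩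

theorem isRuminDifferential_dc (U : Opens (Pt n)) (k : ℕ) : IsRuminDifferential U k (dc U k) := by
  rw [dc, dif_pos (exists_isRuminDifferential U k)]
  exact (exists_isRuminDifferential U k).choose_spec

end

section

/-! ### Locality of the Rumin differential and `d_c ∘ d_c = 0` -/

variable {n : ℕ} {U : Opens (Pt n)} {k : ℕ}

theorem support_extD_subset (ω : TestForm U k) :
    Function.support (extD U k ω) ⊆ tsupport (ω : Pt n → Cov n k) := by
  intro p hp
  refine support_fderiv_subset ℝ (f := (ω : Pt n → Cov n k)) fun h => hp ?_
  rw [extD_apply, extDeriv, h, ← ContinuousAlternatingMap.alternatizeUncurryFinCLM_apply, map_zero]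

theorem tsupport_extD_subset (ω : TestForm U k) :
    tsupport (extD U k ω) ⊆ tsupport (ω : Pt n → Cov n k) :=
  closure_minimal (support_extD_subset ω) (isClosed_tsupport _)

theorem support_subset_tsupport_of_vertical {ω γ : TestForm U n} (h0 : thetaMul U n γ = 0)
    (h1 : thetaMul U (n + 1) (extD U n (ω + γ)) = 0) :
    Function.support γ ⊆ tsupport (ω : Pt n → Cov n n) := by
  intro p hp
  by_contra hpω
  refine hp (eq_zero_of_vertical (testForm_differentiableAt γ p)
    (fun q => DFunLike.congr_fun h0 q) ?_)
  have hω : extD U n ω p = 0 := by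
    by_contra h
    exact hpω (support_extD_subset ω h)
  have h2 : wedge (n + 1) (theta p) (extD U n (ω + γ) p) = 0 := DFunLike.congr_fun h1 p
  rwa [map_add, add_apply, hω, zero_add, extD_apply] at h2

/-- The Rumin differential is the exterior derivative of a suitable representative, whose support
is no larger. -/
theorem exists_dc_eq_extD (ω : reps U k) : ∃ (ζ : TestForm U k) (η : reps U (k + 1)),
    (η : TestForm U (k + 1)) = extD U k ζ ∧ dc U k (cls ω) = cls η ∧
    tsupport (ζ : Pt n → Cov n k) ⊆ tsupport (ω : TestForm U k) := by
  rcases lt_trichotomy k n with hk | hk | hk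
  · obtain ⟨η, h1, h2⟩ := (isRuminDifferential_dc U k).spec_lt hk ω
    exact ⟨ω, η, h1, h2, subset_rfl⟩
  · subst hk
    obtain ⟨γ, η, h0, h1, h2, h3⟩ := (isRuminDifferential_dc U k).spec_eq rfl ω
    refine ⟨ω + γ, η, h2, h3, closure_minimal ?_ (isClosed_tsupport _)⟩
    refine (Function.support_add _ _).trans (Set.union_subset (subset_tsupport _) ?_)
    exact support_subset_tsupport_of_vertical (DFunLike.ext _ _ h0) (DFunLike.ext _ _ h1)
  · obtain ⟨η, h1, h2⟩ := (isRuminDifferential_dc U k).spec_gt hk ω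
    exact ⟨ω, η, h1, h2, subset_rfl⟩

theorem exists_dc_eq_of_tsupport (ω : reps U k) : ∃ η : reps U (k + 1),
    dc U k (cls ω) = cls η ∧
    tsupport (η : TestForm U (k + 1)) ⊆ tsupport (ω : TestForm U k) := by
  obtain ⟨ζ, η, h1, h2, h3⟩ := exists_dc_eq_extD ω
  refine ⟨η, h2, ?_⟩
  rw [h1]
  exact (tsupport_extD_subset ζ).trans h3

theorem cls_eq_zero_of_eq_zero {η : reps U k} (h : (η : TestForm U k) = 0) : cls η = 0 := by
  have : η = 0 := Subtype.ext h
  rw [this]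
  rfl

theorem dc_cls_extD {ζ : TestForm U k} {η : reps U (k + 1)}
    (hη : (η : TestForm U (k + 1)) = extD U k ζ) : dc U (k + 1) (cls η) = 0 := by
  rcases lt_trichotomy (k + 1) n with hk | hk | hk
  · obtain ⟨ξ, h1, h2⟩ := (isRuminDifferential_dc U (k + 1)).spec_lt hk η
    rw [h2, cls_eq_zero_of_eq_zero]
    rw [h1, hη, extD_extD]
  · subst hk
    obtain ⟨γ, ξ, h0, h1, h2, h3⟩ := (isRuminDifferential_dc U (k + 1)).spec_eq rfl η
    rw [h3, cls_eq_zero_of_eq_zero]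
    have h1' : thetaMul U (k + 2) (extD U (k + 1) (η + γ)) = 0 := DFunLike.ext _ _ h1
    rw [map_add, hη, extD_extD, zero_add] at h1'
    have : γ = 0 := vertical_unique
      (by rw [map_zero]; exact DFunLike.ext _ _ h0) (by rw [h1', map_zero, map_zero])
    rw [h2, this, add_zero, hη, extD_extD]
  · obtain ⟨ξ, h1, h2⟩ := (isRuminDifferential_dc U (k + 1)).spec_gt hk η
    rw [h2, cls_eq_zero_of_eq_zero]
    rw [h1, hη, extD_extD]

theorem cls_surjective : Function.Surjective (cls : reps U k → RForm U k) :=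
  Submodule.Quotient.mk_surjective _

theorem dc_dc (x : RForm U k) : dc U (k + 1) (dc U k x) = 0 := by
  obtain ⟨ω, rfl⟩ := cls_surjective x
  obtain ⟨ζ, η, h1, h2, -⟩ := exists_dc_eq_extD ω
  rw [h2, dc_cls_extD h1]

/-! ### The boundary operator -/

theorem current_ext {T S : Current U k} (h : ∀ ω : reps U k, T (cls ω) = S (cls ω)) : T = S := by
  refine ContinuousLinearMap.ext fun x => ?_
  obtain ⟨ω, rfl⟩ := cls_surjective x
  exact h ω

theorem bdry_zero : bdry (0 : Current U k) = 0 := by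
  cases k with
  | zero => rfl
  | succ k => exact ContinuousLinearMap.zero_comp _

theorem bdry_add (T S : Current U k) : bdry (T + S) = bdry T + bdry S := by
  cases k with
  | zero => exact (add_zero 0).symm
  | succ k => exact ContinuousLinearMap.add_comp _ _ _

theorem bdry_sub (T S : Current U k) : bdry (T - S) = bdry T - bdry S := by
  cases k with
  | zero => exact (sub_zero 0).symm
  | succ k => exact ContinuousLinearMap.sub_comp _ _ _

theorem bdry_bdry (T : Current U k) : bdry (bdry T) = 0 := by
  match k, T with
  | 0, T => exact bdry_zero
  | 1, T => rfl
  | k + 2, T =>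
    refine ContinuousLinearMap.ext fun x => ?_
    change T (dc U (k + 1) (dc U k x)) = 0
    rw [dc_dc, map_zero]

end

section

/-! ### Integration of forms against fields of vectors -/

variable {n : ℕ} {U : Opens (Pt n)} {k : ℕ}

/-- A locally bounded function that controls the operator norm of `k`-vectors by `vecNorm`. -/
def normBound (k : ℕ) (p : Pt n) : ℝ :=
  1 + (1 / (k.factorial : ℝ)) * ∑ i : Fin k → Fin n ⊕ Fin n ⊕ Unit,
    (∏ l, ‖frame p (i l)‖) ^ 2

theorem one_le_normBound (k : ℕ) (p : Pt n) : 1 ≤ normBound k p :=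
  le_add_of_nonneg_right (by positivity)

theorem continuous_frame (i : Fin n ⊕ Fin n ⊕ Unit) :
    Continuous fun p : Pt n => frame p i := by
  rcases i with j | j | j <;> simp only [frame] <;> fun_prop

theorem continuous_normBound (k : ℕ) : Continuous (normBound k : Pt n → ℝ) := by
  unfold normBound
  refine continuous_const.add (continuous_const.mul (continuous_finsetSum _ fun i _ => ?_))
  exact (continuous_finsetProd _ fun l _ => (continuous_frame (i l)).norm).pow 2

theorem covInner_self_le (p : Pt n) (ω : Cov n k) :
    covInner p ω ω ≤ normBound k p * ‖ω‖ ^ 2 := by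
  have h : covInner p ω ω ≤ (1 / (k.factorial : ℝ)) * ∑ i : Fin k → Fin n ⊕ Fin n ⊕ Unit,
      (∏ l, ‖frame p (i l)‖) ^ 2 * ‖ω‖ ^ 2 := by
    refine mul_le_mul_of_nonneg_left (Finset.sum_le_sum fun i _ => ?_) (by positivity)
    rw [← sq, ← mul_pow, ← sq_abs, mul_comm]
    exact pow_le_pow_left₀ (abs_nonneg _) (ω.le_opNorm _) 2
  rw [← Finset.sum_mul, ← mul_assoc] at h
  exact h.trans (mul_le_mul_of_nonneg_right (le_add_of_nonneg_left zero_le_one) (by positivity))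

theorem le_one_of_vecNorm_eq_one {p : Pt n} {v : Vec n k} (hv : vecNorm p v = 1) {ω : Cov n k}
    (hω : covInner p ω ω ≤ 1) : v ω ≤ 1 := by
  have hb : BddAbove {r : ℝ | ∃ ω : Cov n k, covInner p ω ω ≤ 1 ∧ r = v ω} := by
    by_contra h
    rw [vecNorm, Real.sSup_of_not_bddAbove h] at hv
    exact zero_ne_one hv
  rw [← hv]
  exact le_csSup hb ⟨ω, hω, rfl⟩

theorem norm_le_of_vecNorm_eq_one {p : Pt n} {v : Vec n k} (hv : vecNorm p v = 1) :
    ‖v‖ ≤ normBound k p := by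
  have hc := one_le_normBound k p
  set c := normBound k p with hcdef
  have key (ω : Cov n k) : v ω ≤ c * ‖ω‖ := by
    rcases eq_or_ne ω 0 with rfl | hω
    · simp
    have hpos : 0 < c * ‖ω‖ := mul_pos (by linarith) (norm_pos_iff.mpr hω)
    have h1 : covInner p ((c * ‖ω‖)⁻¹ • ω) ((c * ‖ω‖)⁻¹ • ω) ≤ 1 := by
      rw [covInner_smul_left, covInner_comm, covInner_smul_left, ← mul_assoc, ← mul_inv,
        inv_mul_le_iff₀ (by positivity), mul_one]
      refine (covInner_self_le p ω).trans ?_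
      have : 0 ≤ (c - 1) * (c * ‖ω‖ ^ 2) := mul_nonneg (by linarith) (by positivity)
      rw [← hcdef]
      nlinarith
    have h2 := le_one_of_vecNorm_eq_one hv h1
    rw [map_smul, smul_eq_mul, inv_mul_le_iff₀ hpos, mul_one] at h2
    exact h2
  refine ContinuousLinearMap.opNorm_le_bound _ (by linarith) fun ω => ?_
  rw [Real.norm_eq_abs, abs_le]
  refine ⟨?_, key ω⟩
  have := key (-ω)
  rw [map_neg, norm_neg] at this
  linarith

section LocallyBounded

variable {E F G : Type*} [NormedAddCommGroup E] [MeasurableSpace E] [BorelSpace E]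
  [LocallyCompactSpace E] [NormedAddCommGroup F] [NormedSpace ℝ F] [NormedAddCommGroup G]
  {Ω : Opens E} {μ : Measure E} {b : E → ℝ}

theorem locallyIntegrableOn_of_ae_norm_le {φ : E → G} (hb : Continuous b)
    (hfin : ∀ K : Set E, IsCompact K → K ⊆ Ω → μ K < ⊤) (hφ : AEStronglyMeasurable φ μ)
    (hle : ∀ᵐ p ∂μ, ‖φ p‖ ≤ b p) (A : Set E) : LocallyIntegrableOn φ Ω (μ.restrict A) := by
  rw [locallyIntegrableOn_iff Ω.isOpen.isLocallyClosed]
  intro K hKΩ hK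
  obtain ⟨C, hC⟩ := hK.exists_bound_of_continuousOn hb.continuousOn
  have h : IntegrableOn φ K μ := by
    refine Measure.integrableOn_of_bounded (M := C) (hfin K hK hKΩ).ne hφ ?_
    filter_upwards [ae_restrict_of_ae hle, ae_restrict_mem hK.measurableSet] with p h1 hp
    exact h1.trans ((le_abs_self _).trans (hC p hp))
  exact h.mono_measure Measure.restrict_le_self

variable [NormedSpace ℝ E]

theorem integralAgainst_eq_setIntegral {φ : E → F →L[ℝ] ℝ} (hb : Continuous b)
    (hfin : ∀ K : Set E, IsCompact K → K ⊆ Ω → μ K < ⊤) (hφ : AEStronglyMeasurable φ μ)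
    (hle : ∀ᵐ p ∂μ, ‖φ p‖ ≤ b p) (A : Set E) (ω : 𝓓(Ω, F)) :
    TestFunction.integralAgainstBilinCLM (ContinuousLinearMap.apply ℝ ℝ) (μ.restrict A) φ ω =
      ∫ p in A, φ p (ω p) ∂μ :=
  TestFunction.integralAgainstBilinCLM_eq_integral
    (locallyIntegrableOn_of_ae_norm_le hb hfin hφ hle A)

theorem integrable_apply_testFunction {φ : E → F →L[ℝ] ℝ} (hb : Continuous b)
    (hfin : ∀ K : Set E, IsCompact K → K ⊆ Ω → μ K < ⊤) (hφ : AEStronglyMeasurable φ μ)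
    (hle : ∀ᵐ p ∂μ, ‖φ p‖ ≤ b p) (ω : 𝓓(Ω, F)) : Integrable (fun p => φ p (ω p)) μ := by
  have h := locallyIntegrableOn_of_ae_norm_le hb hfin hφ hle Set.univ
  rw [Measure.restrict_univ] at h
  exact TestFunction.integrable_bilin (ContinuousLinearMap.apply ℝ ℝ) h ω

end LocallyBounded

namespace IntegralRep

variable {T : Current U k} (R : IntegralRep T)

theorem ae_norm_le : ∀ᵐ p ∂(R.μ), ‖R.τ p‖ ≤ normBound k p := by
  filter_upwards [R.norm_one] with p hp
  exact norm_le_of_vecNorm_eq_one hp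

theorem restrict_cls (A : Set (Pt n)) (ω : reps U k) :
    R.restrict A (cls ω) = ∫ p in A, R.τ p ((ω : TestForm U k) p) ∂(R.μ) :=
  integralAgainst_eq_setIntegral (continuous_normBound k) R.finite_compact R.measurable
    R.ae_norm_le A ω

theorem integrable (ω : TestForm U k) : Integrable (fun p => R.τ p (ω p)) R.μ :=
  integrable_apply_testFunction (continuous_normBound k) R.finite_compact R.measurable
    R.ae_norm_le ω

end IntegralRep

theorem contDiff_smul_id {E F : Type*} [NormedAddCommGroup E] [NormedSpace ℝ E]
    [NormedAddCommGroup F] [NormedSpace ℝ F] {g : E → ℝ} (hg : ContDiff ℝ (⊤ : ℕ∞) g) :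
    ContDiff ℝ (⊤ : ℕ∞) fun p => g p • ContinuousLinearMap.id ℝ F :=
  hg.smul contDiff_const

theorem smul_mem_reps {ω η : TestForm U k} {g : Pt n → ℝ} (hη : ∀ p, η p = g p • ω p)
    (hω : ω ∈ reps U k) : η ∈ reps U k := by
  rcases le_or_gt k n with hk | hk
  · rw [reps_of_le hk]
    trivial
  · rw [reps_of_lt hk] at hω ⊢
    intro p
    rw [hη]
    exact Submodule.smul_mem _ _ (hω p)

/-- A current that vanishes on the forms supported in `V` has a representing field that vanishes
on them. -/
theorem IntegralRep.ae_eq_zero {T : Current U k} (R : IntegralRep T) {V : Set (Pt n)}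
    (hV : ∀ ω : reps U k, tsupport (ω : TestForm U k) ⊆ V → T (cls ω) = 0) (ω : reps U k)
    (hω : tsupport (ω : TestForm U k) ⊆ V) :
    ∀ᵐ p ∂(R.μ), R.τ p ((ω : TestForm U k) p) = 0 := by
  refine ae_eq_zero_of_integral_contDiff_smul_eq_zero (R.integrable ω).locallyIntegrable
    fun g hg _ => ?_
  have hg' : ContDiff ℝ (⊤ : ℕ∞) fun p => g p • ContinuousLinearMap.id ℝ (Cov n k) :=
    contDiff_smul_id hg
  let η : TestForm U k := smoothMulCLM U hg' ω
  have hη (p : Pt n) : η p = g p • (ω : TestForm U k) p := rfl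
  have hsupp : tsupport (η : Pt n → Cov n k) ⊆ tsupport (ω : TestForm U k) :=
    closure_mono (Function.support_subset_iff'.mpr fun p hp => by
      rw [hη, Function.notMem_support.mp hp, smul_zero])
  have h := hV ⟨η, smul_mem_reps hη ω.2⟩ (hsupp.trans hω)
  rw [R.repr] at h
  simpa only [hη, map_smul] using h

/-! ### Restriction of currents -/

theorem res_eq {T : Current U k} (h : IsRepresentable T) (A : Set (Pt n)) :
    res T A = h.some.restrict A := dif_pos h

theorem res_of_not {T : Current U k} (h : ¬IsRepresentable T) (A : Set (Pt n)) :
    res T A = 0 := dif_neg h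

theorem curMeasure_eq {T : Current U k} (h : IsRepresentable T) :
    curMeasure T = h.some.μ := dif_pos h

theorem res_cls_eq_zero_of_vanish {T : Current U k} {V : Set (Pt n)}
    (hV : ∀ ω : reps U k, tsupport (ω : TestForm U k) ⊆ V → T (cls ω) = 0) (A : Set (Pt n))
    (ω : reps U k) (hω : tsupport (ω : TestForm U k) ⊆ V) : res T A (cls ω) = 0 := by
  by_cases h : IsRepresentable T
  · rw [res_eq h, IntegralRep.restrict_cls]
    exact integral_eq_zero_of_ae (ae_restrict_of_ae (h.some.ae_eq_zero hV ω hω))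
  · rw [res_of_not h]
    rfl

theorem res_zero (A : Set (Pt n)) : res (0 : Current U k) A = 0 :=
  current_ext fun ω => res_cls_eq_zero_of_vanish (V := Set.univ) (fun _ _ => rfl) A ω
    (Set.subset_univ _)

theorem res_cls_of_subset {T : Current U k} (h : IsRepresentable T) {A : Set (Pt n)}
    (ω : reps U k) (hω : tsupport (ω : TestForm U k) ⊆ A) : res T A (cls ω) = T (cls ω) := by
  rw [res_eq h, IntegralRep.restrict_cls, h.some.repr]
  refine setIntegral_eq_integral_of_forall_compl_eq_zero (E := ℝ) fun p hp => ?_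
  rw [image_eq_zero_of_notMem_tsupport fun h => hp (hω h), map_zero]

theorem res_cls_of_disjoint {T : Current U k} {A : Set (Pt n)} (ω : reps U k)
    (hω : Disjoint (tsupport (ω : TestForm U k)) A) : res T A (cls ω) = 0 := by
  by_cases h : IsRepresentable T
  · rw [res_eq h, IntegralRep.restrict_cls]
    refine setIntegral_eq_zero_of_forall_eq_zero fun p hp => ?_
    rw [image_eq_zero_of_notMem_tsupport fun h => Set.disjoint_left.mp hω h hp, map_zero]
  · rw [res_of_not h]
    rfl

theorem res_add_res {T : Current U k} (h : IsRepresentable T) {A B : Set (Pt n)}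
    (hB : MeasurableSet B) (hAB : Disjoint A B) (hnull : curMeasure T (A ∪ B)ᶜ = 0) :
    res T A + res T B = T := by
  refine current_ext fun ω => ?_
  rw [curMeasure_eq h] at hnull
  have hμ : h.some.μ.restrict (A ∪ B) = h.some.μ :=
    Measure.restrict_eq_self_of_ae_mem (mem_ae_iff.mpr hnull)
  rw [add_apply, res_eq h, res_eq h, IntegralRep.restrict_cls, IntegralRep.restrict_cls,
    h.some.repr, ← setIntegral_union hAB hB (h.some.integrable ω).integrableOn
      (h.some.integrable ω).integrableOn, hμ]

/-! ### Level sets of Lipschitz functions -/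

theorem continuous_koranyiDist (q : Pt n) : Continuous fun p => koranyiDist p q := by
  unfold koranyiDist koranyiNorm mul inv
  refine Continuous.rpow_const ?_ fun p => Or.inr (by norm_num)
  fun_prop

theorem koranyiDist_self (q : Pt n) : koranyiDist q q = 0 := by
  have h : mul (inv q) q = 0 := by
    have h1 : ∑ j, ((-q).1 j * q.2.1 j - (-q).2.1 j * q.1 j) = 0 :=
      Finset.sum_eq_zero fun j _ => by
        simp only [Prod.fst_neg, Prod.snd_neg, Pi.neg_apply]
        ring
    unfold mul inv
    rw [h1]
    simp [Prod.ext_iff]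
  rw [koranyiDist, h]
  simp [koranyiNorm]

theorem IsLipschitzOn.continuousOn {f : Pt n → ℝ} (hf : IsLipschitzOn U f) :
    ContinuousOn f U := by
  obtain ⟨C, hC⟩ := hf
  intro q hq
  refine tendsto_iff_dist_tendsto_zero.mpr ?_
  have h : Filter.Tendsto (fun p => C * koranyiDist p q) (nhdsWithin q U) (nhds 0) := by
    have := ((continuous_koranyiDist q).const_mul C).tendsto q
    rw [koranyiDist_self, mul_zero] at this
    exact this.mono_left nhdsWithin_le_nhds
  refine squeeze_zero' (Filter.Eventually.of_forall fun _ => dist_nonneg) ?_ h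
  filter_upwards [self_mem_nhdsWithin] with p hp
  exact hC p hp q hq

theorem isOpen_superlevel {f : Pt n → ℝ} (hf : ContinuousOn f U) (t : ℝ) :
    IsOpen {p | p ∈ U ∧ t < f p} :=
  hf.isOpen_inter_preimage U.isOpen isOpen_Ioi

theorem isOpen_sublevel {f : Pt n → ℝ} (hf : ContinuousOn f U) (t : ℝ) :
    IsOpen {p | p ∈ U ∧ f p < t} :=
  hf.isOpen_inter_preimage U.isOpen isOpen_Iio

theorem measurableSet_level {f : Pt n → ℝ} (hf : ContinuousOn f U) (t : ℝ) :
    MeasurableSet {p | p ∈ U ∧ f p = t} := by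
  have h : {p | p ∈ U ∧ f p = t} =
      (U : Set (Pt n)) \ ({p | p ∈ U ∧ t < f p} ∪ {p | p ∈ U ∧ f p < t}) := by
    ext p
    simp only [Set.mem_ofPred_eq, Set.mem_sdiff, SetLike.mem_coe, Set.mem_union]
    constructor
    · rintro ⟨hp, rfl⟩
      simp [hp]
    · rintro ⟨hp, h⟩
      push Not at h
      exact ⟨hp, le_antisymm (not_lt.mp fun h' => absurd h' (not_lt.mpr (h.1 hp))) (h.2 hp)⟩
  rw [h]
  exact U.isOpen.measurableSet.diff
    ((isOpen_superlevel hf t).measurableSet.union (isOpen_sublevel hf t).measurableSet)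

theorem IntegralRep.sigmaFinite {T : Current U k} (R : IntegralRep T) : SigmaFinite R.μ := by
  obtain ⟨K, hK, hKU⟩ : ∃ K : ℕ → Set (Pt n), (∀ i, IsCompact (K i)) ∧ ⋃ i, K i = U := by
    have : LocallyCompactSpace (U : Set (Pt n)) := U.isOpen.locallyCompactSpace
    have : SigmaCompactSpace (U : Set (Pt n)) := inferInstance
    exact isSigmaCompact_iff_sigmaCompactSpace.mpr this
  refine ⟨⟨⟨fun i => K i ∪ (U : Set (Pt n))ᶜ, fun _ => trivial, fun i => ?_, ?_⟩⟩⟩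
  · refine (measure_union_le _ _).trans_lt ?_
    rw [R.carried, add_zero]
    exact R.finite_compact _ (hK i) (hKU ▸ Set.subset_iUnion K i)
  · rw [← Set.iUnion_union, hKU, Set.union_compl_self]

theorem countable_level {T : Current U k} (h : IsRepresentable T) {f : Pt n → ℝ}
    (hf : ContinuousOn f U) :
    {t : ℝ | curMeasure T {p | p ∈ U ∧ f p = t} ≠ 0}.Countable := by
  rw [curMeasure_eq h]
  have := h.some.sigmaFinite
  have hc := Measure.countable_meas_pos_of_disjoint_iUnion (μ := h.some.μ)
    (As := fun t : ℝ => {p | p ∈ U ∧ f p = t}) (measurableSet_level hf)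
    fun s t hst => Set.disjoint_left.mpr fun p hp hq => hst (hp.2.symm.trans hq.2)
  simpa only [pos_iff_ne_zero] using hc

theorem curMeasure_compl_eq_zero {T : Current U k} (h : IsRepresentable T) {f : Pt n → ℝ} {t : ℝ}
    (ht : curMeasure T {p | p ∈ U ∧ f p = t} = 0) :
    curMeasure T ({p | p ∈ U ∧ t < f p} ∪ {p | p ∈ U ∧ f p < t})ᶜ = 0 := by
  have hU : curMeasure T (U : Set (Pt n))ᶜ = 0 := by
    rw [curMeasure_eq h]
    exact h.some.carried
  refine measure_mono_null (fun p hp => ?_) (measure_union_null hU ht)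
  by_cases hpU : p ∈ U
  · refine Or.inr ⟨hpU, ?_⟩
    by_contra hne
    rcases lt_or_gt_of_ne hne with hlt | hlt
    · exact hp (Or.inr ⟨hpU, hlt⟩)
    · exact hp (Or.inl ⟨hpU, hlt⟩)
  · exact Or.inl hpU

/-! ### Slices -/

theorem sliceRight_eq_sliceLeft {T : Current U k} (h : IsRepresentable T)
    (hd : IsRepresentable (bdry T)) {f : Pt n → ℝ} (hf : ContinuousOn f U) {t : ℝ}
    (ht : curMeasure T {p | p ∈ U ∧ f p = t} = 0)
    (htd : curMeasure (bdry T) {p | p ∈ U ∧ f p = t} = 0) :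
    sliceRight T f t = sliceLeft T f t := by
  have hdisj : Disjoint {p | p ∈ U ∧ t < f p} {p | p ∈ U ∧ f p < t} :=
    Set.disjoint_left.mpr fun p hp hq => lt_asymm hp.2 hq.2
  have hm := (isOpen_sublevel hf t).measurableSet
  have h1 := res_add_res h hm hdisj (curMeasure_compl_eq_zero h ht)
  have h2 := res_add_res hd hm hdisj (curMeasure_compl_eq_zero hd htd)
  have h3 := congrArg bdry h1
  rw [bdry_add] at h3
  rw [sliceRight, sliceLeft, sub_eq_sub_iff_add_eq_add, h2, ← h3, add_comm]

theorem spt_sliceRight_subset {T : Current U k} (h : IsRepresentable T)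
    (hd : IsRepresentable (bdry T)) {f : Pt n → ℝ} (hf : ContinuousOn f U) (t : ℝ) :
    spt (sliceRight T f t) ⊆ {p | p ∈ U ∧ f p = t} ∩ spt T := by
  cases k with
  | zero =>
    rintro p ⟨-, hp⟩
    obtain ⟨ω, -, hω⟩ := hp Set.univ isOpen_univ trivial
    refine absurd ?_ hω
    have : sliceRight T f t = res (0 : Current U 0) {p | p ∈ U ∧ t < f p} - 0 := rfl
    rw [this, res_zero, sub_zero]
    rfl
  | succ k =>
    have hslice (ω : reps U k) {η : reps U (k + 1)} (hη : dc U k (cls ω) = cls η) :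
        sliceRight T f t (cls ω) = res (bdry T) {p | p ∈ U ∧ t < f p} (cls ω) -
          res T {p | p ∈ U ∧ t < f p} (cls η) := by
      rw [← hη]
      rfl
    rintro p ⟨hpU, hp⟩
    refine ⟨⟨hpU, ?_⟩, hpU, ?_⟩
    · by_contra hne
      rcases lt_or_gt_of_ne hne with hlt | hlt
      · obtain ⟨ω, hω, hω0⟩ := hp _ (isOpen_sublevel hf t) ⟨hpU, hlt⟩
        obtain ⟨η, hη, hηω⟩ := exists_dc_eq_of_tsupport ω
        have hdisj : Disjoint {p | p ∈ U ∧ f p < t} {p | p ∈ U ∧ t < f p} :=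
          Set.disjoint_left.mpr fun p hp hq => lt_asymm hp.2 hq.2
        refine hω0 ?_
        rw [hslice ω hη, res_cls_of_disjoint ω (hdisj.mono_left hω),
          res_cls_of_disjoint η (hdisj.mono_left (hηω.trans hω)), sub_zero]
      · obtain ⟨ω, hω, hω0⟩ := hp _ (isOpen_superlevel hf t) ⟨hpU, hlt⟩
        obtain ⟨η, hη, hηω⟩ := exists_dc_eq_of_tsupport ω
        refine hω0 ?_
        have hb : bdry T (cls ω) = T (cls η) := by
          rw [← hη]
          rfl
        rw [hslice ω hη, res_cls_of_subset hd ω hω, res_cls_of_subset h η (hηω.trans hω)]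
        exact sub_eq_zero.mpr hb
    · intro V hV hpV
      by_contra! hvan
      have hvand (ω : reps U k) (hω : tsupport (ω : TestForm U k) ⊆ V) :
          bdry T (cls ω) = 0 := by
        obtain ⟨η, hη, hηω⟩ := exists_dc_eq_of_tsupport ω
        change T (dc U k (cls ω)) = 0
        rw [hη, hvan η (hηω.trans hω)]
      obtain ⟨ω, hω, hω0⟩ := hp V hV hpV
      obtain ⟨η, hη, hηω⟩ := exists_dc_eq_of_tsupport ω
      refine hω0 ?_
      rw [hslice ω hη, res_cls_eq_zero_of_vanish hvan _ η (hηω.trans hω)]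
      exact (sub_zero _).trans (res_cls_eq_zero_of_vanish hvand _ ω hω)

theorem bdry_sliceRight (T : Current U k) (f : Pt n → ℝ) (t : ℝ) :
    bdry (sliceRight T f t) = -sliceRight (bdry T) f t := by
  simp only [sliceRight, bdry_sub, bdry_bdry, res_zero, sub_zero, zero_sub, neg_neg]

end

end Heis

end

theorem mainTheorem1 {n k : ℕ} (U : TopologicalSpace.Opens (Heis.Pt n)) (T : Heis.Current U k)
    (hT : Heis.IsNormal T) (f : Heis.Pt n → ℝ) (hf : Heis.IsLipschitzOn U f) :
    {t : ℝ | (Heis.curMeasure T + Heis.curMeasure (Heis.bdry T))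
      {p | p ∈ U ∧ f p = t} ≠ 0}.Countable ∧
    {t : ℝ | Heis.sliceRight T f t ≠ Heis.sliceLeft T f t}.Countable ∧
    (∀ t : ℝ, Heis.spt (Heis.sliceRight T f t) ⊆ {p | p ∈ U ∧ f p = t} ∩ Heis.spt T) ∧
    (∀ t : ℝ, Heis.bdry (Heis.sliceRight T f t) = -Heis.sliceRight (Heis.bdry T) f t) := by
  have hc := hf.continuousOn
  have h := hT.representable
  have hd := hT.representable_bdry
  have hcount : {t : ℝ | (Heis.curMeasure T + Heis.curMeasure (Heis.bdry T))
      {p | p ∈ U ∧ f p = t} ≠ 0}.Countable := by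
    refine ((Heis.countable_level h hc).union (Heis.countable_level hd hc)).mono fun t ht => ?_
    by_contra hn
    simp only [Set.mem_union, Set.mem_ofPred_eq, not_or, not_not] at hn
    exact ht (by rw [MeasureTheory.Measure.add_apply, hn.1, hn.2, add_zero])
  refine ⟨hcount, hcount.mono ?_, fun t => Heis.spt_sliceRight_subset h hd hc t,
    fun t => Heis.bdry_sliceRight T f t⟩
  intro t ht
  by_contra h0
  simp only [Set.mem_ofPred_eq, not_not, MeasureTheory.Measure.add_apply, add_eq_zero] at h0
  exact ht (Heis.sliceRight_eq_sliceLeft h hd hc h0.1 h0.2)
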